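/- For each $n\ge 1$ let $C(z)=\frac{1}{\sqrt n}\sum_{1\le j<k\le n}J_{jk}z_jz_k$, $z\in\{+1,-1\}^n$, be the Sherrington–Kirkpatrick cost function, where the $J_{jk}$ are independent and identically distributed with an arbitrary fixed law on $\mathbb R$ (not depending on $n$) of mean $0$ and variance $1$ (for instance the standard normal law). View $C$ as the operator $C|z\rangle=C(z)|z\rangle$ on $n$ qubits, let $B=\sum_{j=1}^nX_j$ with $X_j$ the Pauli $X$ operator on qubit $j$, let $|s\rangle=2^{-n/2}\sum_z|z\rangle$, and for $\boldsymbol\gamma=(\gamma_1,\gamma_2)\in\mathbb R^2$, $\boldsymbol\beta=(\beta_1,\beta_2)\in\mathbb R^2$ let $$|\boldsymbol\gamma,\boldsymbol\beta\rangle=e^{-i\beta_2B}e^{-i\gamma_2C}e^{-i\beta_1B}e^{-i\gamma_1C}|s\rangle$$ be the QAOA state with $p=2$ layers. Then, for all real $\gamma_1,\gamma_2,\beta_1,\beta_2$, the random variable $\langle\boldsymbol\gamma,\boldsymbol\beta|C/n|\boldsymbol\gamma,\boldsymbol\beta\rangle$ is integrable for every $n$, the limit $V_2(\boldsymbol\gamma,\boldsymbol\beta)=\lim_{n\to\infty}\mathbb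 E_J\big[\langle\boldsymbol\gamma,\boldsymbol\beta|C/n|\boldsymbol\gamma,\boldsymbol\beta\rangle\big]$ exists, and $$V_2(\boldsymbol\gamma,\boldsymbol\beta)=\big[\gamma_1\Gamma_1+\gamma_2\Gamma_2\big]\exp\big(-2(\gamma_1^2+\gamma_2^2)\big),$$ where $$\Gamma_1=2\Big(e^{2\gamma_2^2}\sin2\beta_1\cos2\beta_2+\sin2\beta_2\,(\cos2\beta_1\cosh\Omega-\sinh\Omega)\Big)\Big(\cos2\beta_1\cos2\beta_2-e^{-2\gamma_2^2}\sin2\beta_1\sin2\beta_2\cos\Lambda\Big),$$ $$\Gamma_2=\Big(\cosh\Omega+e^{2\gamma_1^2}\sin2\beta_1\sin\Lambda-\cos2\beta_1\sinh\Omega\Big)\sin4\beta_2,$$ $$\Lambda=4\gamma_1\gamma_2\sin2\beta_1\,e^{-2\gamma_1^2},\qquad \Omega=4\gamma_1\gamma_2\cos2\beta_1.$$ -/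

import Mathlib

open MeasureTheory Matrix

noncomputable section

namespace SKQAOA

/-- Spin strings `z ∈ {+1, -1}ⁿ`; they label the computational basis of `n` qubits. -/
abbrev Spins (n : ℕ) : Type := Fin n → ℤˣ

/-- Index set of the couplings: the pairs `(j, k)` with `j < k`. -/
abbrev Pairs (n : ℕ) : Type := {e : Fin n × Fin n // e.1 < e.2}

/-- State vectors of `n` qubits, in the computational basis. -/
abbrev State (n : ℕ) : Type := Spins n → ℂ

/-- Operators on `n` qubits, in the computational basis. -/
abbrev Op (n : ℕ) : Type := Matrix (Spins n) (Spins n) ℂ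

/-- The Sherrington-Kirkpatrick cost function `C(z) = n^{-1/2} ∑_{j<k} J_{jk} z_j z_k`. -/
def cost {n : ℕ} (J : Pairs n → ℝ) (z : Spins n) : ℝ :=
  (1 / Real.sqrt n) * ∑ e : Pairs n, J e * ((z e.1.1 : ℤ) : ℝ) * ((z e.1.2 : ℤ) : ℝ)

/-- The diagonal operator `C |z⟩ = C(z) |z⟩`. -/
def costOp {n : ℕ} (J : Pairs n → ℝ) : Op n :=
  Matrix.diagonal fun z => (cost J z : ℂ)

/-- The Pauli `X` operator on qubit `j`: it maps `|z⟩` to `|z with z_j negated⟩`. -/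
def pauliX {n : ℕ} (j : Fin n) : Op n :=
  Matrix.of fun z z' => if z = Function.update z' j (-z' j) then 1 else 0

/-- The mixing operator `B = ∑_j X_j`. -/
def mixOp (n : ℕ) : Op n := ∑ j : Fin n, pauliX j

/-- `U(C, γ) = e^{-iγC}` (matrix exponential). -/
def costUnitary {n : ℕ} (J : Pairs n → ℝ) (γ : ℝ) : Op n :=
  NormedSpace.exp ((-(Complex.I * (γ : ℂ))) • costOp J)

/-- `U(B, β) = e^{-iβB}` (matrix exponential). -/
def mixUnitary (n : ℕ) (β : ℝ) : Op n :=
  NormedSpace.exp ((-(Complex.I * (β : ℂ))) • mixOp n)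

/-- The uniform superposition `|s⟩ = 2^{-n/2} ∑_z |z⟩`. -/
def plusState (n : ℕ) : State n := fun _ => ((1 / Real.sqrt (2 ^ n) : ℝ) : ℂ)

/-- The QAOA state
`|γ, β⟩ = U(B, β_p) U(C, γ_p) ⋯ U(B, β_1) U(C, γ_1) |s⟩`; the parameters of layer `r`
are stored at index `r - 1`. -/
def qaoaState {n : ℕ} (J : Pairs n → ℝ) : (p : ℕ) → (Fin p → ℝ) → (Fin p → ℝ) → State n
  | 0, _, _ => plusState n
  | p + 1, γ, β =>
      mixUnitary n (β (Fin.last p)) *ᵥ (costUnitary J (γ (Fin.last p)) *ᵥ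
        qaoaState J p (fun r => γ r.castSucc) (fun r => β r.castSucc))

/-- The quantum expectation `⟨γ, β| C/n |γ, β⟩`. -/
def energyDensity {n : ℕ} (J : Pairs n → ℝ) (p : ℕ) (γ β : Fin p → ℝ) : ℂ :=
  star (qaoaState J p γ β) ⬝ᵥ (((1 / (n : ℂ)) • costOp J) *ᵥ qaoaState J p γ β)

/-- The law of the couplings `J_{jk}`, `j < k`: independent, each with law `μ`. -/
def couplingLaw (μ : Measure ℝ) (n : ℕ) : Measure (Pairs n → ℝ) :=
  Measure.pi fun _ => μ

/-- `Λ = 4 γ₁ γ₂ sin 2β₁ exp(-2γ₁²)` -/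
def Lam (γ₁ γ₂ β₁ : ℝ) : ℝ :=
  4 * γ₁ * γ₂ * Real.sin (2 * β₁) * Real.exp (-2 * γ₁ ^ 2)

/-- `Ω = 4 γ₁ γ₂ cos 2β₁` -/
def Omg (γ₁ γ₂ β₁ : ℝ) : ℝ :=
  4 * γ₁ * γ₂ * Real.cos (2 * β₁)

def Gamma1 (γ₁ γ₂ β₁ β₂ : ℝ) : ℝ :=
  2 * (Real.exp (2 * γ₂ ^ 2) * Real.sin (2 * β₁) * Real.cos (2 * β₂)
      + Real.sin (2 * β₂) * (Real.cos (2 * β₁) * Real.cosh (Omg γ₁ γ₂ β₁)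
          - Real.sinh (Omg γ₁ γ₂ β₁)))
    * (Real.cos (2 * β₁) * Real.cos (2 * β₂)
      - Real.exp (-2 * γ₂ ^ 2) * Real.sin (2 * β₁) * Real.sin (2 * β₂)
          * Real.cos (Lam γ₁ γ₂ β₁))

def Gamma2 (γ₁ γ₂ β₁ β₂ : ℝ) : ℝ :=
  (Real.cosh (Omg γ₁ γ₂ β₁)
      + Real.exp (2 * γ₁ ^ 2) * Real.sin (2 * β₁) * Real.sin (Lam γ₁ γ₂ β₁)
      - Real.cos (2 * β₁) * Real.sinh (Omg γ₁ γ₂ β₁))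
    * Real.sin (4 * β₂)

end SKQAOA

end

namespace SKQAOA

open MeasureTheory Matrix Filter Topology

/-! Expanding both layers turns the energy into a sum over paths: each qubit carries a ket and a bra
spin after each of the two mixers (m, m') and in the initial state (a, a'). The phase of a path is
linear in the couplings, so the average over independent J factorises. For the term of `cost` at a
pair e, the coupling J_e contributes `charMoment` at φ/√n, asymptotically iφ/√n, and every other
coupling a characteristic function, 1 - φ²/(2n) + o(1/n). Only these second-order expansions matter,
so the limit depends on the law only through its mean and variance.

Qubits outside e (the bulk) are not measured. Unitarity of the last mixer forces m = m' there, so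
two bulk qubits interact only through a and a', and only if exactly one of them has a ≠ a'; the
phase is then ±2γ₁. If S is the set of bulk qubits with a ≠ a', the bulk interaction is therefore
close to exp(-2γ₁²)^|S| as long as |S| is much smaller than √n. Unitarity of the first mixer makes
the total weight of a ≠ a' vanish; coupling to the end points of e restores a weight of order 1/n
only, so large S are negligible. The bulk thus decouples into the (n-2)-th power of a one-qubit sum
1 + ℓ/n + o(1/n), which tends to exp ℓ, with ℓ a sum of one `pathExponent` per end point
(`norm_prod_bulk_sub_le`, `norm_bulkSum_sub_le`, `exists_norm_bulkSum_sub_le`).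

About n²/2 pairs contribute equally, so the limit is half of a double sum over the paths at the two
end points, weighted by `limitWeight` and iφ. As φ is a combination of differences of products, this
is a combination of differences of squares of single sums, which are computed explicitly
(`sum_limitWeight_phase`). -/

/-! ### Matrix elements of the two unitaries -/

open scoped Nat in
/-- Euler's formula for an involution of a Banach algebra. -/
theorem exp_smul_of_mul_self_eq_one {A : Type*} [NormedRing A] [NormedAlgebra ℂ A]
    [CompleteSpace A] {x : A} (hx : x * x = 1) (t : ℂ) :
    NormedSpace.exp (t • x) = Complex.cosh t • (1 : A) + Complex.sinh t • x := by
  have he : ∀ k : ℕ, x ^ (2 * k) = 1 := fun k => by rw [pow_mul, pow_two, hx, one_pow]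
  have h1 := NormedSpace.exp_series_hasSum_exp' (𝕂 := ℂ) (t • x)
  refine h1.unique (HasSum.even_add_odd ?_ ?_)
  · have := (Complex.hasSum_cosh t).smul_const (1 : A)
    refine this.congr_fun fun k => ?_
    rw [smul_pow, he, smul_smul]
    congr 1
    ring
  · have := (Complex.hasSum_sinh t).smul_const x
    refine this.congr_fun fun k => ?_
    rw [smul_pow, pow_succ x, he, smul_smul, one_mul]
    congr 1
    ring

theorem exp_smul_matrix_of_mul_self_eq_one {m : Type*} [Fintype m] [DecidableEq m]
    {X : Matrix m m ℂ} (hX : X * X = 1) (t : ℂ) :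
    NormedSpace.exp (t • X) = Complex.cosh t • (1 : Matrix m m ℂ) + Complex.sinh t • X := by
  open scoped Matrix.Norms.Operator in
  exact exp_smul_of_mul_self_eq_one hX t

theorem eq_update_neg_iff {n : ℕ} (j : Fin n) (z w : Spins n) :
    z = Function.update w j (-w j) ↔ w = Function.update z j (-z j) := by
  constructor <;> rintro rfl <;> simp

theorem pauliX_mul_apply {n : ℕ} (j : Fin n) (M : Op n) (z z' : Spins n) :
    (pauliX j * M) z z' = M (Function.update z j (-z j)) z' := by
  rw [Matrix.mul_apply, Finset.sum_eq_single (Function.update z j (-z j))]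
  · simp [pauliX]
  · intro w _ hw
    have h : ¬z = Function.update w j (-w j) := fun h => hw ((eq_update_neg_iff j z w).1 h)
    simp [pauliX, h]
  · simp

theorem pauliX_mul_self {n : ℕ} (j : Fin n) : pauliX j * pauliX j = (1 : Op n) := by
  ext z z'
  rw [pauliX_mul_apply]
  simp only [pauliX, Matrix.of_apply, Matrix.one_apply, eq_update_neg_iff]
  simp [eq_comm]

theorem pauliX_commute {n : ℕ} (j k : Fin n) : Commute (pauliX j) (pauliX (n := n) k) := by
  rcases eq_or_ne j k with rfl | h
  · exact Commute.refl _
  ext z z'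
  rw [pauliX_mul_apply, pauliX_mul_apply]
  simp only [pauliX, Matrix.of_apply, eq_update_neg_iff]
  simp [h, h.symm, Function.update_comm h]

/-- Matrix elements of `exp (-iβX)` on a single qubit. -/
noncomputable def kern (β : ℝ) (z w : ℤˣ) : ℂ :=
  if z = w then (Real.cos β : ℂ) else -(Complex.I * (Real.sin β : ℂ))

theorem exp_sum_pauliX_apply {n : ℕ} (β : ℝ) (s : Finset (Fin n)) (z w : Spins n) :
    (NormedSpace.exp ((-(Complex.I * (β : ℂ))) • ∑ j ∈ s, pauliX j) : Op n) z w =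
      ∏ j, if j ∈ s then kern β (z j) (w j) else if z j = w j then 1 else 0 := by
  induction s using Finset.induction_on generalizing z with
  | empty =>
    simp only [Finset.sum_empty, smul_zero, NormedSpace.exp_zero, Finset.notMem_empty, if_false]
    rw [Matrix.one_apply, Finset.prod_ite_zero]
    simp [funext_iff]
  | insert k s hk ih =>
    -- Euler's formula for `pauliX k` leaves two terms that differ only by a flip of z_k, hence only
    -- in the factor of qubit k.
    rw [Finset.sum_insert hk, smul_add, Matrix.exp_add_of_commute,
      exp_smul_matrix_of_mul_self_eq_one (pauliX_mul_self k), add_mul, smul_mul_assoc,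
      smul_mul_assoc, one_mul, Matrix.add_apply, Matrix.smul_apply, Matrix.smul_apply,
      pauliX_mul_apply, ih, ih, ← Finset.mul_prod_erase _ _ (Finset.mem_univ k),
      ← Finset.mul_prod_erase _ _ (Finset.mem_univ k),
      ← Finset.mul_prod_erase _ _ (Finset.mem_univ k)]
    · have h1 : ∀ j ∈ Finset.univ.erase k,
          (if j ∈ s then kern β (Function.update z k (-z k) j) (w j)
            else if Function.update z k (-z k) j = w j then 1 else 0) =
          if j ∈ s then kern β (z j) (w j) else if z j = w j then 1 else 0 := by
        intro j hj
        rw [Function.update_of_ne (Finset.ne_of_mem_erase hj)]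
      have h2 : ∀ j ∈ Finset.univ.erase k,
          (if j ∈ insert k s then kern β (z j) (w j) else if z j = w j then 1 else 0) =
          if j ∈ s then kern β (z j) (w j) else if z j = w j then 1 else 0 := by
        intro j hj
        simp [Finset.ne_of_mem_erase hj]
      rw [Finset.prod_congr rfl h1, Finset.prod_congr rfl h2]
      simp only [hk, if_false, Finset.mem_insert_self, if_true, Function.update_self, smul_eq_mul]
      rw [← mul_assoc, ← mul_assoc, ← add_mul]
      congr 1
      have hc : Complex.cosh (-(Complex.I * β)) = Complex.cos β := by
        rw [Complex.cosh_neg, mul_comm, Complex.cosh_mul_I]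
      have hs : Complex.sinh (-(Complex.I * β)) = -(Complex.I * Complex.sin β) := by
        rw [Complex.sinh_neg, mul_comm, Complex.sinh_mul_I, mul_comm]
      rw [hc, hs, kern]
      rcases Int.units_eq_one_or (z k) with h | h <;> rcases Int.units_eq_one_or (w k) with h' | h' <;>
        simp [h, h', show (-1 : ℤˣ) ≠ 1 by decide, show (1 : ℤˣ) ≠ -1 by decide]
    · exact ((Commute.sum_right _ _ _ fun j _ => pauliX_commute k j).smul_left _).smul_right _

theorem mixUnitary_apply {n : ℕ} (β : ℝ) (z w : Spins n) :
    mixUnitary n β z w = ∏ j, kern β (z j) (w j) := by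
  rw [mixUnitary, mixOp, exp_sum_pauliX_apply]
  simp only [Finset.mem_univ, if_true]

theorem costUnitary_mulVec_apply {n : ℕ} (J : Pairs n → ℝ) (γ : ℝ) (ψ : State n) (z : Spins n) :
    (costUnitary J γ *ᵥ ψ) z = Complex.exp (-(Complex.I * γ) * cost J z) * ψ z := by
  rw [costUnitary, costOp, ← Matrix.diagonal_smul, Matrix.exp_diagonal, Matrix.mulVec_diagonal]
  simp [Complex.exp_eq_exp_ℂ]

theorem qaoaState_two_apply {n : ℕ} (J : Pairs n → ℝ) (γ₁ γ₂ β₁ β₂ : ℝ) (z : Spins n) :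
    qaoaState J 2 ![γ₁, γ₂] ![β₁, β₂] z =
      ∑ m : Spins n, ∑ a : Spins n,
        (∏ j, kern β₂ (z j) (m j) * kern β₁ (m j) (a j)) *
          Complex.exp (-(Complex.I * (γ₂ * cost J m + γ₁ * cost J a))) *
          ((1 / Real.sqrt (2 ^ n) : ℝ) : ℂ) := by
  simp only [qaoaState]
  rw [Matrix.mulVec, dotProduct]
  refine Finset.sum_congr rfl fun m _ => ?_
  rw [costUnitary_mulVec_apply, Matrix.mulVec, dotProduct, Finset.mul_sum, Finset.mul_sum]
  refine Finset.sum_congr rfl fun a _ => ?_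
  rw [costUnitary_mulVec_apply, mixUnitary_apply, mixUnitary_apply, Finset.prod_mul_distrib]
  have h : Complex.exp (-(Complex.I * (γ₂ * cost J m + γ₁ * cost J a))) =
      Complex.exp (-(Complex.I * γ₂) * cost J m) * Complex.exp (-(Complex.I * γ₁) * cost J a) := by
    rw [← Complex.exp_add]
    congr 1
    ring
  rw [h]
  simp only [plusState, show Fin.last 1 = (1 : Fin 2) from rfl,
    show (Fin.last 0).castSucc = (0 : Fin 2) from rfl, Matrix.cons_val_zero, Matrix.cons_val_one]
  ring

/-! ### The energy as a sum over paths -/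

/-- The values `((m, m'), (a, a'))` along the four inner slices of a two-layer path sum at a
single qubit: primed spins belong to the bra, unprimed ones to the ket. -/
abbrev SpinPath : Type := (ℤˣ × ℤˣ) × (ℤˣ × ℤˣ)

/-- The real value of a spin. -/
def spinVal (z : ℤˣ) : ℝ := ((z : ℤ) : ℝ)

/-- The coefficient of `J_{jk} / √n` in the phase of a path. -/
def phase (γ₁ γ₂ : ℝ) (p q : SpinPath) : ℝ :=
  γ₁ * (spinVal p.2.2 * spinVal q.2.2 - spinVal p.2.1 * spinVal q.2.1) +
    γ₂ * (spinVal p.1.2 * spinVal q.1.2 - spinVal p.1.1 * spinVal q.1.1)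

/-- The amplitude of a single-qubit path with final spin `z`. -/
noncomputable def pathAmp (β₁ β₂ : ℝ) (z : ℤˣ) (q : SpinPath) : ℂ :=
  (1 / 2) * (kern β₂ z q.1.1 * kern β₁ q.1.1 q.2.1 *
    (starRingEnd ℂ (kern β₂ z q.1.2) * starRingEnd ℂ (kern β₁ q.1.2 q.2.2)))

/-- The weight of a single-qubit path at a qubit that is not measured. -/
noncomputable def bulkWeight (β₁ β₂ : ℝ) (q : SpinPath) : ℂ := ∑ z, pathAmp β₁ β₂ z q

/-- The weight of a single-qubit path at a qubit on which Pauli `Z` is measured. -/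
noncomputable def coreWeight (β₁ β₂ : ℝ) (q : SpinPath) : ℂ :=
  ∑ z, (spinVal z : ℂ) * pathAmp β₁ β₂ z q

theorem sum_prodMk_eq {ι α β M : Type*} [Fintype ι] [DecidableEq ι] [Fintype α] [Fintype β]
    [AddCommMonoid M] (F : (ι → α) → (ι → β) → M) :
    ∑ q : ι → α × β, F (fun i => (q i).1) (fun i => (q i).2) = ∑ x, ∑ y, F x y := by
  rw [← Fintype.sum_prod_type' F, ← (Equiv.arrowProdEquivProdArrow ι (fun _ => α) (fun _ => β)).sum_comp]
  rfl

theorem sum_spinPath_eq {n : ℕ} (F : Spins n → Spins n → Spins n → Spins n → ℂ) :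
    ∑ q : Fin n → SpinPath, F (fun i => (q i).1.1) (fun i => (q i).1.2) (fun i => (q i).2.1)
      (fun i => (q i).2.2) = ∑ m, ∑ m', ∑ a, ∑ a', F m m' a a' := by
  rw [sum_prodMk_eq (fun (x y : Fin n → ℤˣ × ℤˣ) =>
    F (fun i => (x i).1) (fun i => (x i).2) (fun i => (y i).1) (fun i => (y i).2))]
  have h : ∀ x : Fin n → ℤˣ × ℤˣ, ∑ y : Fin n → ℤˣ × ℤˣ,
      F (fun i => (x i).1) (fun i => (x i).2) (fun i => (y i).1) (fun i => (y i).2) =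
      ∑ a, ∑ a', F (fun i => (x i).1) (fun i => (x i).2) a a' := fun x =>
    sum_prodMk_eq (fun a a' => F (fun i => (x i).1) (fun i => (x i).2) a a')
  simp_rw [h]
  exact sum_prodMk_eq (fun m m' => ∑ a, ∑ a', F m m' a a')

theorem cost_eq {n : ℕ} (J : Pairs n → ℝ) (z : Spins n) :
    cost J z = ∑ e : Pairs n, J e * (spinVal (z e.1.1) * spinVal (z e.1.2) / Real.sqrt n) := by
  rw [cost, Finset.mul_sum]
  refine Finset.sum_congr rfl fun e _ => ?_
  simp only [spinVal]
  ring

theorem cost_combination {n : ℕ} (J : Pairs n → ℝ) (γ₁ γ₂ : ℝ) (q : Fin n → SpinPath) :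
    γ₂ * cost J (fun i => (q i).1.2) + γ₁ * cost J (fun i => (q i).2.2) -
      (γ₂ * cost J (fun i => (q i).1.1) + γ₁ * cost J (fun i => (q i).2.1)) =
      ∑ e : Pairs n, J e * (phase γ₁ γ₂ (q e.1.1) (q e.1.2) / Real.sqrt n) := by
  simp only [cost_eq, Finset.mul_sum]
  rw [← Finset.sum_add_distrib, ← Finset.sum_add_distrib, ← Finset.sum_sub_distrib]
  refine Finset.sum_congr rfl fun e _ => ?_
  simp only [phase]
  ring

theorem star_qaoaState_mul_self {n : ℕ} (J : Pairs n → ℝ) (γ₁ γ₂ β₁ β₂ : ℝ) (z : Spins n) :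
    star (qaoaState J 2 ![γ₁, γ₂] ![β₁, β₂] z) * qaoaState J 2 ![γ₁, γ₂] ![β₁, β₂] z =
      ∑ q : Fin n → SpinPath, (∏ j, pathAmp β₁ β₂ (z j) (q j)) *
        Complex.exp (Complex.I * (∑ e : Pairs n,
          J e * (phase γ₁ γ₂ (q e.1.1) (q e.1.2) / Real.sqrt n) : ℝ)) := by
  -- The normalisation of the two initial states is spread as one factor 1/2 per qubit, the one in
  -- `pathAmp`.
  have hs : ((1 / Real.sqrt (2 ^ n) : ℝ) : ℂ) * ((1 / Real.sqrt (2 ^ n) : ℝ) : ℂ) =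
      (1 / 2) ^ n := by
    rw [← Complex.ofReal_mul, div_mul_div_comm, Real.mul_self_sqrt (by positivity)]
    push_cast
    simp
  -- An opaque `F` lets the rewrite with `sum_spinPath_eq` match syntactically.
  obtain ⟨F, hF⟩ : ∃ F : Spins n → Spins n → Spins n → Spins n → ℂ, ∀ m m' a a', F m m' a a' =
      (∏ _j : Fin n, (1 / 2 : ℂ)) * ((∏ j, kern β₂ (z j) (m j) * kern β₁ (m j) (a j)) *
        (∏ j, starRingEnd ℂ (kern β₂ (z j) (m' j)) * starRingEnd ℂ (kern β₁ (m' j) (a' j)))) *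
      Complex.exp (Complex.I * (γ₂ * cost J m' + γ₁ * cost J a' -
        (γ₂ * cost J m + γ₁ * cost J a) : ℝ)) := ⟨_, fun _ _ _ _ => rfl⟩
  have h2 : ∀ q : Fin n → SpinPath, (∏ j, pathAmp β₁ β₂ (z j) (q j)) *
        Complex.exp (Complex.I * (∑ e : Pairs n,
          J e * (phase γ₁ γ₂ (q e.1.1) (q e.1.2) / Real.sqrt n) : ℝ)) =
      F (fun i => (q i).1.1) (fun i => (q i).1.2) (fun i => (q i).2.1) (fun i => (q i).2.2) := by
    intro q
    rw [← cost_combination, hF]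
    simp only [pathAmp, Finset.prod_mul_distrib]
  simp_rw [h2]
  rw [sum_spinPath_eq, qaoaState_two_apply, star_sum, Finset.sum_mul_sum, Finset.sum_comm]
  refine Finset.sum_congr rfl fun m _ => Finset.sum_congr rfl fun m' _ => ?_
  rw [star_sum, Finset.sum_mul_sum, Finset.sum_comm]
  refine Finset.sum_congr rfl fun a _ => Finset.sum_congr rfl fun a' _ => ?_
  rw [hF, Finset.prod_const, Finset.card_univ, Fintype.card_fin, ← hs]
  simp only [star_mul', Complex.star_def, map_prod, map_mul, ← Complex.exp_conj, map_neg, map_add,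
    Complex.conj_I, Complex.conj_ofReal]
  have he : Complex.exp (Complex.I * (γ₂ * cost J m' + γ₁ * cost J a' -
      (γ₂ * cost J m + γ₁ * cost J a) : ℝ)) =
      Complex.exp (-(-Complex.I * (γ₂ * cost J m' + γ₁ * cost J a'))) *
      Complex.exp (-(Complex.I * (γ₂ * cost J m + γ₁ * cost J a))) := by
    rw [← Complex.exp_add]
    congr 1
    push_cast
    ring
  rw [he]
  ring

theorem prod_spinVal_ite {n : ℕ} (e : Pairs n) (z : Spins n) :
    (∏ j, if j = e.1.1 ∨ j = e.1.2 then (spinVal (z j) : ℂ) else 1) =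
      spinVal (z e.1.1) * spinVal (z e.1.2) := by
  have hne : e.1.1 ≠ e.1.2 := e.2.ne
  rw [← Finset.prod_filter, show (Finset.univ.filter fun j => j = e.1.1 ∨ j = e.1.2) =
    {e.1.1, e.1.2} by ext; simp, Finset.prod_pair hne]

/-- The energy density as a sum over paths. -/
theorem energyDensity_two_eq {n : ℕ} (J : Pairs n → ℝ) (γ₁ γ₂ β₁ β₂ : ℝ) :
    energyDensity J 2 ![γ₁, γ₂] ![β₁, β₂] =
      (1 / (n : ℂ)) * (1 / Real.sqrt n : ℝ) * ∑ e : Pairs n, ∑ q : Fin n → SpinPath,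
        (∏ j, if j = e.1.1 ∨ j = e.1.2 then coreWeight β₁ β₂ (q j) else bulkWeight β₁ β₂ (q j)) *
        (J e * Complex.exp (Complex.I * (∑ e' : Pairs n,
          J e' * (phase γ₁ γ₂ (q e'.1.1) (q e'.1.2) / Real.sqrt n) : ℝ))) := by
  -- For a fixed path the sum over the final string z factorises over qubits; the factor z_j z_k of
  -- the pair distinguishes core from bulk weights.
  have hw : ∀ (e : Pairs n) (q : Fin n → SpinPath),
      (∏ j, if j = e.1.1 ∨ j = e.1.2 then coreWeight β₁ β₂ (q j) else bulkWeight β₁ β₂ (q j)) =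
      ∑ z : Spins n, (spinVal (z e.1.1) * spinVal (z e.1.2) : ℂ) *
        ∏ j, pathAmp β₁ β₂ (z j) (q j) := by
    intro e q
    have : ∀ z : Spins n, (spinVal (z e.1.1) * spinVal (z e.1.2) : ℂ) *
        ∏ j, pathAmp β₁ β₂ (z j) (q j) =
        ∏ j, (if j = e.1.1 ∨ j = e.1.2 then (spinVal (z j) : ℂ) else 1) *
          pathAmp β₁ β₂ (z j) (q j) := fun z => by
      rw [Finset.prod_mul_distrib, prod_spinVal_ite]
    simp_rw [this]
    rw [← Fintype.prod_sum (fun j z => (if j = e.1.1 ∨ j = e.1.2 then (spinVal z : ℂ) else 1) *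
          pathAmp β₁ β₂ z (q j))]
    refine Finset.prod_congr rfl fun j _ => ?_
    split_ifs <;> simp [coreWeight, bulkWeight]
  simp_rw [hw]
  rw [energyDensity, dotProduct]
  have h1 : ∀ z : Spins n, star (qaoaState J 2 ![γ₁, γ₂] ![β₁, β₂]) z *
      (((1 / (n : ℂ)) • costOp J) *ᵥ qaoaState J 2 ![γ₁, γ₂] ![β₁, β₂]) z =
      (1 / (n : ℂ)) * (1 / Real.sqrt n : ℝ) * ∑ e : Pairs n,
        ∑ q : Fin n → SpinPath, ((spinVal (z e.1.1) * spinVal (z e.1.2) : ℂ) *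
          ∏ j, pathAmp β₁ β₂ (z j) (q j)) *
        (J e * Complex.exp (Complex.I * (∑ e' : Pairs n,
          J e' * (phase γ₁ γ₂ (q e'.1.1) (q e'.1.2) / Real.sqrt n) : ℝ))) := by
    intro z
    rw [costOp, ← Matrix.diagonal_smul, Matrix.mulVec_diagonal, Pi.star_apply]
    have h2 := star_qaoaState_mul_self J γ₁ γ₂ β₁ β₂ z
    calc _ = (1 / (n : ℂ)) * cost J z * (star (qaoaState J 2 ![γ₁, γ₂] ![β₁, β₂] z) *
            qaoaState J 2 ![γ₁, γ₂] ![β₁, β₂] z) := by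
          simp only [Pi.smul_apply, smul_eq_mul]
          ring
      _ = _ := by
          rw [h2, cost]
          push_cast
          rw [mul_assoc, mul_assoc, mul_assoc, Finset.sum_mul]
          congr 2
          refine Finset.sum_congr rfl fun e _ => ?_
          rw [Finset.mul_sum]
          refine Finset.sum_congr rfl fun q _ => ?_
          simp only [spinVal]
          push_cast
          ring
  rw [Finset.sum_congr rfl fun z _ => h1 z, ← Finset.mul_sum, Finset.sum_comm]
  congr 1
  refine Finset.sum_congr rfl fun e _ => ?_
  rw [Finset.sum_comm]
  refine Finset.sum_congr rfl fun q _ => ?_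
  rw [Finset.sum_mul]

/-! ### Averaging over independent couplings -/

/-- The first-moment analogue `∫ x e^{isx} dμ` of the characteristic function. -/
noncomputable def charMoment (μ : Measure ℝ) (s : ℝ) : ℂ :=
  ∫ x, (x : ℂ) * Complex.exp (Complex.I * (x * s : ℝ)) ∂μ

section
variable {ι : Type*} [Fintype ι] [DecidableEq ι] (μ : Measure ℝ) [IsProbabilityMeasure μ]

/-- A product of functions of one coupling each is the form to which Fubini applies, both for
integrability and for the integral. -/
theorem mul_exp_sum_eq_prod (θ : ι → ℝ) (e : ι) (J : ι → ℝ) :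
    (J e : ℂ) * Complex.exp (Complex.I * (∑ e', J e' * θ e' : ℝ)) =
      ∏ e', (if e' = e then (J e' : ℂ) else 1) *
        Complex.exp (Complex.I * (J e' * θ e' : ℝ)) := by
  rw [Finset.prod_mul_distrib, ← Complex.exp_sum, ← Finset.mul_sum]
  simp

theorem integrable_factor {μ : Measure ℝ} [IsProbabilityMeasure μ]
    (hμ : Integrable (fun x : ℝ => x) μ) (p : Prop) [Decidable p] (s : ℝ) :
    Integrable (fun x : ℝ => (if p then (x : ℂ) else 1) *
      Complex.exp (Complex.I * (x * s : ℝ))) μ := by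
  have h : Integrable (fun x : ℝ => if p then (x : ℂ) else 1) μ := by
    split_ifs
    · exact hμ.ofReal
    · exact integrable_const _
  refine h.mul_bdd (c := 1) ?_ ?_
  · exact Continuous.aestronglyMeasurable (by fun_prop)
  · refine Filter.Eventually.of_forall fun x => ?_
    rw [mul_comm, Complex.norm_exp_ofReal_mul_I]

theorem integrable_mul_exp_sum {μ : Measure ℝ} [IsProbabilityMeasure μ]
    (hμ : Integrable (fun x : ℝ => x) μ) (θ : ι → ℝ) (e : ι) :
    Integrable (fun J : ι → ℝ => (J e : ℂ) *
      Complex.exp (Complex.I * (∑ e', J e' * θ e' : ℝ))) (Measure.pi fun _ => μ) := by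
  simp_rw [mul_exp_sum_eq_prod]
  exact Integrable.fintype_prod fun e' => integrable_factor hμ _ _

theorem integral_mul_exp_sum (θ : ι → ℝ) (e : ι) :
    ∫ J : ι → ℝ, (J e : ℂ) * Complex.exp (Complex.I * (∑ e', J e' * θ e' : ℝ))
        ∂(Measure.pi fun _ => μ) =
      charMoment μ (θ e) * ∏ e' ∈ Finset.univ.erase e, charFun μ (θ e') := by
  simp_rw [mul_exp_sum_eq_prod]
  rw [integral_fintype_prod_eq_prod
    (fun e' (x : ℝ) => (if e' = e then (x : ℂ) else 1) * Complex.exp (Complex.I * (x * θ e' : ℝ))),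
    ← Finset.mul_prod_erase _ _ (Finset.mem_univ e)]
  congr 1
  · simp [charMoment]
  · refine Finset.prod_congr rfl fun e' he => ?_
    rw [charFun_apply_real]
    simp only [Finset.ne_of_mem_erase he, if_false, one_mul]
    refine integral_congr_ae (Filter.Eventually.of_forall fun x => ?_)
    simp only
    congr 1
    push_cast
    ring

end

/-! ### Asymptotics of a single coupling at scale 1/√n -/

section
variable {μ : Measure ℝ} [IsProbabilityMeasure μ]

theorem tendsto_inv_sqrt_natCast_nhdsGT :
    Tendsto (fun n : ℕ => (Real.sqrt n)⁻¹) atTop (𝓝[>] 0) :=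
  tendsto_inv_atTop_nhdsGT_zero.comp (Real.tendsto_sqrt_atTop.comp tendsto_natCast_atTop_atTop)

/-- `charMoment` is -i times the derivative of the characteristic function and vanishes at 0, so the
left side is a difference quotient at 0 with step 1/√n; the second derivative there is -1. -/
theorem tendsto_sqrt_mul_charMoment (hL2 : MemLp (fun x : ℝ => x) 2 μ)
    (hmean : ∫ x, x ∂μ = 0) (hvar : ∫ x, x ^ 2 ∂μ = 1) (t : ℝ) :
    Tendsto (fun n : ℕ => (Real.sqrt n : ℂ) * charMoment μ (t / Real.sqrt n)) atTop
      (𝓝 (Complex.I * t)) := by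
  have h1 : MemLp id ((1 : ℕ) : ENNReal) μ := by
    exact MemLp.mono_exponent (q := 2) hL2 (by norm_num)
  have hd : ∀ s, deriv (charFun μ) s = Complex.I * charMoment μ s := by
    intro s
    have h := iteratedDeriv_charFun (t := s) h1
    rw [iteratedDeriv_one] at h
    rw [h, charMoment, pow_one]
    congr 1
    refine integral_congr_ae (Filter.Eventually.of_forall fun x => ?_)
    simp only [pow_one]
    congr 2
    push_cast
    ring
  have hc : ContDiff ℝ 2 (charFun μ) := contDiff_charFun (n := 2) hL2
  have h2 : HasDerivAt (deriv (charFun μ)) (-1) 0 := by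
    have hdd : DifferentiableAt ℝ (deriv (charFun μ)) 0 := by
      have := (contDiff_succ_iff_deriv (n := 1).1 hc).2.2
      exact this.differentiable (by norm_num) 0
    have h := iteratedDeriv_charFun_zero (n := 2) (μ := μ) hL2
    rw [iteratedDeriv_succ, iteratedDeriv_one, hvar] at h
    have h' := hdd.hasDerivAt
    rw [h] at h'
    simpa using h'
  have h3 : HasDerivAt (fun s => charMoment μ (t * s)) (Complex.I * t) 0 := by
    have h4 : HasDerivAt (fun s => -Complex.I * deriv (charFun μ) (t * s)) (-Complex.I * (t • (-1))) 0 := by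
      refine HasDerivAt.const_mul _ ?_
      refine HasDerivAt.scomp (g₁ := deriv (charFun μ)) (h := fun s => t * s) 0 (by simpa using h2) ?_
      simpa using (hasDerivAt_id (0 : ℝ)).const_mul t
    convert! h4 using 1
    · funext s
      rw [hd, ← mul_assoc]
      simp
    · simp
  have h0 : charMoment μ 0 = 0 := by
    simp only [charMoment, mul_zero, Complex.ofReal_zero, Complex.exp_zero, mul_one]
    rw [integral_complex_ofReal, hmean, Complex.ofReal_zero]
  have h5 := h3.tendsto_slope_zero_right.comp tendsto_inv_sqrt_natCast_nhdsGT
  refine h5.congr fun n => ?_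
  simp [h0, div_eq_mul_inv]

theorem tendsto_mul_charFun_sub_one (hmean : ∫ x, x ∂μ = 0) (hvar : ∫ x, x ^ 2 ∂μ = 1) (t : ℝ) :
    Tendsto (fun n : ℕ => (n : ℂ) * (charFun μ (t / Real.sqrt n) - 1)) atTop
      (𝓝 (-(t ^ 2 / 2))) := by
  have h := taylor_charFun_two (P := μ) (X := fun x => x) aemeasurable_id' hmean hvar
  rw [Measure.map_id'] at h
  have ht : Tendsto (fun n : ℕ => t / Real.sqrt n) atTop (𝓝 0) := by
    simpa [div_eq_mul_inv] using
      (tendsto_nhdsWithin_iff.1 tendsto_inv_sqrt_natCast_nhdsGT).1.const_mul t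
  have h1 := h.comp_tendsto ht
  have h3 := (Asymptotics.isBigO_refl (fun n : ℕ => (n : ℝ)) atTop).smul_isLittleO h1
  have hn : ∀ᶠ n : ℕ in atTop, (n : ℝ) * (t / Real.sqrt n) ^ 2 = t ^ 2 := by
    filter_upwards [eventually_gt_atTop 0] with n hn
    have hn' : (0 : ℝ) < n := by exact_mod_cast hn
    rw [div_pow, Real.sq_sqrt hn'.le, mul_div_cancel₀ _ hn'.ne']
  have h4 : (fun n : ℕ => (n : ℝ) • ((fun n : ℕ => t / Real.sqrt n) n) ^ 2) =O[atTop]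
      fun _ => (1 : ℝ) :=
    (Asymptotics.isBigO_const_const (t ^ 2) one_ne_zero atTop).congr'
      (hn.mono fun n h => h.symm) EventuallyEq.rfl
  have h5 := ((Asymptotics.isLittleO_one_iff ℝ).1 (h3.trans_isBigO h4)).add_const
    (-((t : ℂ) ^ 2 / 2))
  rw [zero_add] at h5
  refine h5.congr' ?_
  filter_upwards [hn] with n hn
  have hn' : (n : ℂ) * ((t / Real.sqrt n : ℝ) : ℂ) ^ 2 = t ^ 2 := by exact_mod_cast hn
  simp only [Function.comp, Complex.real_smul, Complex.ofReal_natCast]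
  linear_combination (1 / 2) * hn'

theorem tendsto_mul_charFun_mul_charFun_sub_one (hmean : ∫ x, x ∂μ = 0)
    (hvar : ∫ x, x ^ 2 ∂μ = 1) (s t : ℝ) :
    Tendsto (fun n : ℕ => (n : ℂ) *
      (charFun μ (s / Real.sqrt n) * charFun μ (t / Real.sqrt n) - 1)) atTop
      (𝓝 (-((s ^ 2 + t ^ 2) / 2))) := by
  have ht := tendsto_mul_charFun_sub_one hmean hvar t
  have hs := tendsto_mul_charFun_sub_one hmean hvar s
  have h1 : Tendsto (fun n : ℕ => charFun μ (t / Real.sqrt n)) atTop (𝓝 1) := by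
    have hc : ContinuousAt (charFun μ) 0 := (continuous_charFun (μ := μ)).continuousAt
    have hz : Tendsto (fun n : ℕ => t / Real.sqrt n) atTop (𝓝 0) := by
      simpa [div_eq_mul_inv] using
        (tendsto_nhdsWithin_iff.1 tendsto_inv_sqrt_natCast_nhdsGT).1.const_mul t
    simpa [charFun_zero, Function.comp_def] using hc.tendsto.comp hz
  have h2 := (hs.mul h1).add ht
  refine (h2.congr fun n => by ring).trans (le_of_eq ?_)
  congr 1
  ring

end

/-! ### Products over pairs and decoupling of the bulk -/

/-- The product of a symmetric function over all pairs with one end in each of two disjoint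
sets. -/
theorem prod_pairs_crossing {n : ℕ} {M : Type*} [CommMonoid M] {F : Fin n → Fin n → M}
    (hF : ∀ j k, F j k = F k j) {S S' : Finset (Fin n)} (hd : Disjoint S S') :
    ∏ e : Pairs n with (e.1.1 ∈ S ∧ e.1.2 ∈ S') ∨ (e.1.2 ∈ S ∧ e.1.1 ∈ S'), F e.1.1 e.1.2 =
      ∏ j ∈ S, ∏ k ∈ S', F j k := by
  have hdis : ∀ {j}, j ∈ S → j ∈ S' → False := fun h h' => Finset.disjoint_left.1 hd h h'
  rw [← Finset.prod_product']
  -- Each ordered pair j < k is reoriented so that its end in `S` comes first.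
  refine Finset.prod_bij (fun e _ => if e.1.1 ∈ S then (e.1.1, e.1.2) else (e.1.2, e.1.1))
    ?_ ?_ ?_ ?_
  · intro e he
    simp only [Finset.mem_filter, Finset.mem_univ, true_and] at he
    rw [Finset.mem_product]
    split_ifs with h
    · rcases he with he | he
      · exact he
      · exact (hdis h he.2).elim
    · rcases he with he | he
      · exact (h he.1).elim
      · exact he
  · rintro ⟨⟨a, b⟩, hab⟩ h1 ⟨⟨c, d⟩, hcd⟩ h2 h
    simp only at h hab hcd
    split_ifs at h
    all_goals
      rw [Prod.mk.injEq] at h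
      obtain ⟨rfl, rfl⟩ := h
    · rfl
    · exact (lt_asymm hab hcd).elim
    · exact (lt_asymm hab hcd).elim
    · rfl
  · rintro ⟨j, k⟩ hjk
    rw [Finset.mem_product] at hjk
    have hne : j ≠ k := fun h => hdis hjk.1 (h ▸ hjk.2)
    rcases lt_or_gt_of_ne hne with h | h
    · exact ⟨⟨(j, k), h⟩, by simp [hjk.1, hjk.2], by simp [hjk.1]⟩
    · refine ⟨⟨(k, j), h⟩, by simp [hjk.1, hjk.2], ?_⟩
      have : k ∉ S := fun h' => hdis h' hjk.2
      simp [this]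
  · intro e he
    split_ifs
    · rfl
    · exact hF _ _

/-- The qubits that are not end points of a given pair. -/
def bulk {n : ℕ} (e : Pairs n) : Finset (Fin n) := {e.1.1, e.1.2}ᶜ

theorem mem_bulk {n : ℕ} {e : Pairs n} {j : Fin n} : j ∈ bulk e ↔ j ≠ e.1.1 ∧ j ≠ e.1.2 := by
  simp [bulk]

theorem card_bulk {n : ℕ} (e : Pairs n) : (bulk e).card = n - 2 := by
  rw [bulk, Finset.card_compl, Finset.card_pair e.2.ne, Fintype.card_fin]

theorem two_le_of_pair {n : ℕ} (e : Pairs n) : 2 ≤ n := by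
  have h1 := e.2
  have h2 := e.1.2.2
  rw [Fin.lt_def] at h1
  omega

theorem prod_pairs_erase {n : ℕ} {M : Type*} [CommMonoid M] {F : Fin n → Fin n → M}
    (hF : ∀ j k, F j k = F k j) (e : Pairs n) :
    ∏ e' ∈ Finset.univ.erase e, F e'.1.1 e'.1.2 =
      (∏ k ∈ bulk e, F e.1.1 k * F e.1.2 k) *
        ∏ e' : Pairs n with e'.1.1 ∈ bulk e ∧ e'.1.2 ∈ bulk e, F e'.1.1 e'.1.2 := by
  rw [← Finset.prod_filter_not_mul_prod_filter (Finset.univ.erase e)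
    (fun e' : Pairs n => e'.1.1 ∈ bulk e ∧ e'.1.2 ∈ bulk e)]
  congr 1
  · have h := prod_pairs_crossing hF (S := {e.1.1, e.1.2}) (S' := bulk e) disjoint_compl_right
    rw [Finset.prod_pair e.2.ne, ← Finset.prod_mul_distrib] at h
    rw [← h]
    refine Finset.prod_congr ?_ fun _ _ => rfl
    ext e'
    have hlt := e'.2
    have hlt' := e.2
    simp only [Finset.mem_filter, Finset.mem_erase, Finset.mem_univ, mem_bulk, Finset.mem_insert,
      Finset.mem_singleton]
    grind
  · refine Finset.prod_congr ?_ fun _ _ => rfl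
    ext e'
    simp only [Finset.mem_filter, Finset.mem_erase, Finset.mem_univ, mem_bulk, and_true, true_and,
      ne_eq, and_iff_right_iff_imp]
    rintro ⟨h, _⟩ rfl
    exact h.1 rfl

/-- Telescoping: the factors are exchanged one at a time, all others having norm at most 1. -/
theorem norm_prod_sub_prod_le {ι : Type*} (s : Finset ι) {x y : ι → ℂ}
    (hx : ∀ i ∈ s, ‖x i‖ ≤ 1) (hy : ∀ i ∈ s, ‖y i‖ ≤ 1) :
    ‖∏ i ∈ s, x i - ∏ i ∈ s, y i‖ ≤ ∑ i ∈ s, ‖x i - y i‖ := by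
  classical
  induction s using Finset.induction_on with
  | empty => simp
  | insert a s ha ih =>
    rw [Finset.prod_insert ha, Finset.prod_insert ha, Finset.sum_insert ha]
    have h1 := ih (fun i hi => hx i (Finset.mem_insert_of_mem hi))
      (fun i hi => hy i (Finset.mem_insert_of_mem hi))
    have h2 : ‖∏ i ∈ s, x i‖ ≤ 1 := by
      rw [norm_prod]
      exact Finset.prod_le_one (fun _ _ => norm_nonneg _)
        fun i hi => hx i (Finset.mem_insert_of_mem hi)
    have h3 := hy a (Finset.mem_insert_self a s)
    calc ‖x a * ∏ i ∈ s, x i - y a * ∏ i ∈ s, y i‖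
        = ‖(x a - y a) * ∏ i ∈ s, x i + y a * (∏ i ∈ s, x i - ∏ i ∈ s, y i)‖ := by
          congr 1
          ring
      _ ≤ ‖x a - y a‖ * ‖∏ i ∈ s, x i‖ + ‖y a‖ * ‖∏ i ∈ s, x i - ∏ i ∈ s, y i‖ := by
          refine (norm_add_le _ _).trans ?_
          rw [norm_mul, norm_mul]
      _ ≤ ‖x a - y a‖ * 1 + 1 * ∑ i ∈ s, ‖x i - y i‖ := by gcongr
      _ = _ := by ring

theorem abs_exp_neg_sub_exp_neg_le {x y : ℝ} (hx : 0 ≤ x) (hxy : x ≤ y) :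
    |Real.exp (-x) - Real.exp (-y)| ≤ y - x := by
  have h1 : Real.exp (-y) = Real.exp (-x) * Real.exp (-(y - x)) := by
    rw [← Real.exp_add]
    congr 1
    ring
  have h2 : Real.exp (-x) ≤ 1 := Real.exp_le_one_iff.2 (by linarith)
  have h3 := Real.add_one_le_exp (-(y - x))
  have h4 : Real.exp (-(y - x)) ≤ 1 := Real.exp_le_one_iff.2 (by linarith)
  have h5 := Real.exp_pos (-x)
  rw [h1, abs_of_nonneg (by nlinarith)]
  nlinarith

/-- If two spins interact only across a set `S`, and then with a factor close to `exp (-g / n)`,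
the interaction of the bulk is close to `exp (-g) ^ |S|`. -/
theorem norm_prod_bulk_sub_le {n : ℕ} (e : Pairs n) {f : Fin n → Fin n → ℂ}
    (hsymm : ∀ j k, f j k = f k j) (hf : ∀ j k, ‖f j k‖ ≤ 1) {S : Finset (Fin n)}
    (hS : S ⊆ bulk e) (hone : ∀ j ∈ bulk e, ∀ k ∈ bulk e, (j ∈ S ↔ k ∈ S) → f j k = 1) {g δ : ℝ} (hg : 0 ≤ g)
    (hδ : ∀ j ∈ S, ∀ k ∈ bulk e \ S, ‖f j k - Real.exp (-(g / n))‖ ≤ δ) (hδ0 : 0 ≤ δ) :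
    ‖∏ e' : Pairs n with e'.1.1 ∈ bulk e ∧ e'.1.2 ∈ bulk e, f e'.1.1 e'.1.2 -
      (Real.exp (-g) : ℂ) ^ S.card‖ ≤ (n * δ + 3 * (g / n)) * 4 ^ S.card := by
  have hn2 := two_le_of_pair e
  have hn : (0 : ℝ) < n := by exact_mod_cast (by omega : 0 < n)
  have h1 : ∏ e' : Pairs n with e'.1.1 ∈ bulk e ∧ e'.1.2 ∈ bulk e, f e'.1.1 e'.1.2 =
      ∏ j ∈ S, ∏ k ∈ bulk e \ S, f j k := by
    rw [← prod_pairs_crossing hsymm Finset.disjoint_sdiff]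
    symm
    refine Finset.prod_subset ?_ ?_
    · intro e' he
      simp only [Finset.mem_filter, Finset.mem_univ, true_and, Finset.mem_sdiff] at he ⊢
      rcases he with h | h
      · exact ⟨hS h.1, h.2.1⟩
      · exact ⟨h.2.1, hS h.1⟩
    · intro e' he he'
      simp only [Finset.mem_filter, Finset.mem_univ, true_and, Finset.mem_sdiff] at he he'
      exact hone _ he.1 _ he.2 (by tauto)
  have hcard : ((bulk e \ S).card : ℝ) = n - 2 - S.card := by
    have h := Finset.card_sdiff_add_card_eq_card hS
    rw [card_bulk] at h
    have h' : (bulk e \ S).card + S.card + 2 = n := by omega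
    have h'' : ((bulk e \ S).card : ℝ) + S.card + 2 = n := by exact_mod_cast h'
    linarith
  have hc0 : (0 : ℝ) ≤ (bulk e \ S).card := Nat.cast_nonneg _
  have hk0 : (0 : ℝ) ≤ S.card := Nat.cast_nonneg _
  have hk1 : (S.card : ℝ) ≤ S.card ^ 2 := by
    exact_mod_cast Nat.le_self_pow (by norm_num) _
  -- The quadratic error in |S| is relaxed to an exponential one because the latter is a product
  -- over qubits and can be summed over all paths.
  have hk2 : (S.card : ℝ) ^ 2 ≤ 4 ^ S.card := by
    have h : S.card ^ 2 ≤ (2 ^ S.card) ^ 2 := Nat.pow_le_pow_left Nat.lt_two_pow_self.le 2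
    rw [← pow_mul, mul_comm, pow_mul] at h
    exact_mod_cast h
  have h2 : ‖∏ j ∈ S, ∏ k ∈ bulk e \ S, f j k -
      ∏ j ∈ S, ∏ k ∈ bulk e \ S, (Real.exp (-(g / n)) : ℂ)‖ ≤ S.card * (n * δ) := by
    have hexp : ‖(Real.exp (-(g / n)) : ℂ)‖ ≤ 1 := by
      rw [Complex.norm_real, Real.norm_eq_abs, abs_of_pos (Real.exp_pos _), Real.exp_le_one_iff]
      have : 0 ≤ g / n := by positivity
      linarith
    rw [← Finset.prod_product', ← Finset.prod_product' (f := fun _ _ => (Real.exp (-(g / n)) : ℂ))]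
    refine (norm_prod_sub_prod_le _ (fun p _ => hf _ _) fun _ _ => hexp).trans ?_
    refine (Finset.sum_le_card_nsmul _ _ δ ?_).trans ?_
    · intro p hp
      rw [Finset.mem_product] at hp
      exact hδ _ hp.1 _ hp.2
    · rw [Finset.card_product, nsmul_eq_mul]
      push_cast
      rw [mul_assoc]
      have hle : ((bulk e \ S).card : ℝ) ≤ n := by linarith
      exact mul_le_mul_of_nonneg_left (mul_le_mul_of_nonneg_right hle hδ0) hk0
  -- Each element of `S` has n - 2 - |S| partners instead of n; the deficit of |S| + 2 factors costs
  -- g/n each.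
  have h3 : ‖∏ j ∈ S, ∏ k ∈ bulk e \ S, (Real.exp (-(g / n)) : ℂ) -
      (Real.exp (-g) : ℂ) ^ S.card‖ ≤ S.card * (S.card + 2) * (g / n) := by
    rw [Finset.prod_const, Finset.prod_const, ← pow_mul, ← Complex.ofReal_pow,
      ← Complex.ofReal_pow, ← Complex.ofReal_sub, Complex.norm_real, Real.norm_eq_abs,
      ← Real.exp_nat_mul, ← Real.exp_nat_mul, mul_neg, mul_neg]
    refine (abs_exp_neg_sub_exp_neg_le (by positivity) ?_).trans (le_of_eq ?_)
    · have hle : ((bulk e \ S).card : ℝ) / n ≤ 1 := by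
        rw [div_le_one hn]
        linarith
      calc _ = S.card * g * (((bulk e \ S).card : ℝ) / n) := by
            push_cast
            ring
        _ ≤ S.card * g * 1 := by gcongr
        _ = _ := mul_one _
    · push_cast
      rw [hcard]
      field_simp
      ring
  rw [h1]
  calc _ ≤ S.card * (n * δ) + S.card * (S.card + 2) * (g / n) := by
        refine (norm_sub_le_norm_sub_add_norm_sub _ _ _).trans (add_le_add h2 h3)
    _ ≤ S.card ^ 2 * (n * δ) + (3 * S.card ^ 2) * (g / n) := by
        have h4 : (S.card : ℝ) * (S.card + 2) ≤ 3 * S.card ^ 2 := by nlinarith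
        have h5 : (0 : ℝ) ≤ n * δ := by positivity
        exact add_le_add (mul_le_mul_of_nonneg_right hk1 h5)
          (mul_le_mul_of_nonneg_right h4 (by positivity))
    _ = (n * δ + 3 * (g / n)) * S.card ^ 2 := by ring
    _ ≤ _ := by gcongr

/-! ### One-qubit sums and unitarity -/

/-- A site-dependent function that is exceptional at the two end points of a pair. -/
def siteFun {n : ℕ} {α β : Type*} (e : Pairs n) (v₁ v₂ v : α → β) (j : Fin n) : α → β :=
  if j = e.1.1 then v₁ else if j = e.1.2 then v₂ else v

theorem prod_eq_mul_prod_bulk {n : ℕ} {M : Type*} [CommMonoid M] (e : Pairs n) (h : Fin n → M) :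
    ∏ j, h j = h e.1.1 * h e.1.2 * ∏ j ∈ bulk e, h j := by
  rw [bulk, ← Finset.prod_pair e.2.ne, Finset.prod_mul_prod_compl]

theorem prod_siteFun {n : ℕ} {α M : Type*} [CommMonoid M] (e : Pairs n) (v₁ v₂ v : α → M)
    (x : Fin n → α) : ∏ j, siteFun e v₁ v₂ v j (x j) =
      v₁ (x e.1.1) * v₂ (x e.1.2) * ∏ j ∈ bulk e, v (x j) := by
  rw [prod_eq_mul_prod_bulk e]
  congr 1
  · simp [siteFun, e.2.ne']
  · refine Finset.prod_congr rfl fun j hj => ?_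
    rw [mem_bulk] at hj
    simp [siteFun, hj]

theorem sum_prod_siteFun {n : ℕ} {α R : Type*} [CommSemiring R] [Fintype α] (e : Pairs n)
    (v₁ v₂ v : α → R) : ∑ x : Fin n → α, ∏ j, siteFun e v₁ v₂ v j (x j) =
      (∑ a, v₁ a) * (∑ a, v₂ a) * (∑ a, v a) ^ (n - 2) := by
  rw [← Fintype.prod_sum, prod_eq_mul_prod_bulk e]
  congr 1
  · simp [siteFun, e.2.ne']
  · rw [← card_bulk e, ← Finset.prod_const]
    refine Finset.prod_congr rfl fun j hj => ?_
    rw [mem_bulk] at hj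
    simp [siteFun, hj]

theorem sum_kern_mul_conj (β : ℝ) (a b : ℤˣ) :
    ∑ z, kern β z a * starRingEnd ℂ (kern β z b) = if a = b then 1 else 0 := by
  have h : ((Real.cos β : ℂ)) ^ 2 + (Real.sin β : ℂ) ^ 2 = 1 := by
    exact_mod_cast Real.cos_sq_add_sin_sq β
  rw [show (Finset.univ : Finset ℤˣ) = {1, -1} from rfl, Finset.sum_pair (by decide)]
  rcases Int.units_eq_one_or a with rfl | rfl <;> rcases Int.units_eq_one_or b with rfl | rfl <;>
    simp only [kern, show (-1 : ℤˣ) ≠ 1 by decide, show (1 : ℤˣ) ≠ -1 by decide, if_true,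
      if_false, map_neg, map_mul, Complex.conj_I, Complex.conj_ofReal]
  · linear_combination h - (Real.sin β : ℂ) ^ 2 * Complex.I_sq
  · ring
  · ring
  · linear_combination h - (Real.sin β : ℂ) ^ 2 * Complex.I_sq

/-- Unitarity of the last mixer: without a measurement, the sum over the final spin removes β₂ and
identifies the two middle spins. -/
theorem bulkWeight_eq (β₁ β₂ : ℝ) (q : SpinPath) :
    bulkWeight β₁ β₂ q = if q.1.1 = q.1.2 then
      1 / 2 * (kern β₁ q.1.1 q.2.1 * starRingEnd ℂ (kern β₁ q.1.2 q.2.2)) else 0 := by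
  have h := sum_kern_mul_conj β₂ q.1.1 q.1.2
  calc bulkWeight β₁ β₂ q = (∑ z, kern β₂ z q.1.1 * starRingEnd ℂ (kern β₂ z q.1.2)) *
        (1 / 2 * (kern β₁ q.1.1 q.2.1 * starRingEnd ℂ (kern β₁ q.1.2 q.2.2))) := by
        rw [bulkWeight, Finset.sum_mul]
        refine Finset.sum_congr rfl fun z _ => ?_
        rw [pathAmp]
        ring
    _ = _ := by
        rw [h]
        split_ifs <;> simp

theorem sum_bulkWeight (β₁ β₂ : ℝ) (b : ℤˣ × ℤˣ) :
    ∑ m, bulkWeight β₁ β₂ (m, b) = if b.1 = b.2 then 1 / 2 else 0 := by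
  have h := sum_kern_mul_conj β₁ b.1 b.2
  simp_rw [bulkWeight_eq, Fintype.sum_prod_type]
  simp only [Finset.sum_ite_eq, Finset.mem_univ, if_true]
  rw [← Finset.mul_sum, h]
  split_ifs <;> simp

/-- For equal initial spins the weights are nonnegative reals, so nothing is lost by taking norms.
-/
theorem sum_norm_bulkWeight (β₁ β₂ : ℝ) (a : ℤˣ) :
    ∑ m, ‖bulkWeight β₁ β₂ (m, (a, a))‖ = 1 / 2 := by
  have h : ∀ m, ((‖bulkWeight β₁ β₂ (m, (a, a))‖ : ℝ) : ℂ) = bulkWeight β₁ β₂ (m, (a, a)) := by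
    rintro ⟨m, m'⟩
    rw [bulkWeight_eq]
    simp only
    split_ifs with h
    · subst h
      rw [Complex.mul_conj]
      simp [abs_of_nonneg (Complex.normSq_nonneg _)]
    · simp
  have h2 := sum_bulkWeight β₁ β₂ (a, a)
  rw [if_pos rfl, ← Finset.sum_congr rfl fun m _ => h m, ← Complex.ofReal_sum] at h2
  refine Complex.ofReal_injective (h2.trans ?_)
  push_cast
  rfl

/-- The phase coefficient of the bra and ket spins right after the initial state. -/
def layerPhase (γ : ℝ) (b b' : ℤˣ × ℤˣ) : ℝ :=
  γ * (spinVal b.2 * spinVal b'.2 - spinVal b.1 * spinVal b'.1)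

theorem phase_comm (γ₁ γ₂ : ℝ) (p q : SpinPath) : phase γ₁ γ₂ p q = phase γ₁ γ₂ q p := by
  simp only [phase]
  ring

theorem phase_eq_layerPhase (γ₁ γ₂ : ℝ) {p q : SpinPath} (hp : p.1.1 = p.1.2)
    (hq : q.1.1 = q.1.2) : phase γ₁ γ₂ p q = layerPhase γ₁ p.2 q.2 := by
  simp [phase, layerPhase, hp, hq]

theorem layerPhase_comm (γ : ℝ) (b b' : ℤˣ × ℤˣ) : layerPhase γ b b' = layerPhase γ b' b := by
  simp only [layerPhase]
  ring

/-- Passing from ket to bra flips both spins or neither, so their product is unchanged. -/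
theorem layerPhase_eq_zero (γ : ℝ) {b b' : ℤˣ × ℤˣ} (h : b.1 = b.2 ↔ b'.1 = b'.2) :
    layerPhase γ b b' = 0 := by
  obtain ⟨a, a'⟩ := b
  obtain ⟨c, c'⟩ := b'
  rcases Int.units_eq_one_or a with rfl | rfl <;> rcases Int.units_eq_one_or a' with rfl | rfl <;>
  rcases Int.units_eq_one_or c with rfl | rfl <;> rcases Int.units_eq_one_or c' with rfl | rfl <;>
  simp_all [layerPhase, spinVal]

theorem layerPhase_eq_or (γ : ℝ) {b b' : ℤˣ × ℤˣ} (h : b.1 ≠ b.2) (h' : b'.1 = b'.2) :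
    layerPhase γ b b' = 2 * γ ∨ layerPhase γ b b' = -(2 * γ) := by
  obtain ⟨a, a'⟩ := b
  obtain ⟨c, c'⟩ := b'
  simp only at h h'
  subst h'
  rcases Int.units_eq_one_or a with rfl | rfl <;> rcases Int.units_eq_one_or a' with rfl | rfl <;>
  rcases Int.units_eq_one_or c with rfl | rfl <;>
  simp only [layerPhase, spinVal, ne_eq, not_true_eq_false] at h ⊢ <;> push_cast
  · right; ring
  · left; ring
  · left; ring
  · right; ring

/-! ### Summing out the bulk qubits -/

section
variable (μ : Measure ℝ) (γ₁ γ₂ β₁ β₂ : ℝ) (n : ℕ)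

/-- The weight of a bulk path dressed by the averaged couplings to two fixed paths. -/
noncomputable def dressedWeight (c₁ c₂ q : SpinPath) : ℂ :=
  bulkWeight β₁ β₂ q * (charFun μ (phase γ₁ γ₂ c₁ q / Real.sqrt n) *
    charFun μ (phase γ₁ γ₂ c₂ q / Real.sqrt n))

/-- The averaged interaction of the bulk qubits with each other. -/
noncomputable def bulkFactor {n : ℕ} (e : Pairs n) (b : Fin n → ℤˣ × ℤˣ) : ℂ :=
  ∏ e' : Pairs n with e'.1.1 ∈ bulk e ∧ e'.1.2 ∈ bulk e,
    charFun μ (layerPhase γ₁ (b e'.1.1) (b e'.1.2) / Real.sqrt n)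

/-- The averaged path sum with the paths at the end points of `e` held fixed. -/
noncomputable def bulkSum {n : ℕ} (e : Pairs n) (c₁ c₂ : SpinPath) : ℂ :=
  ∑ q : Fin n → SpinPath,
    (∏ j, siteFun e (fun p => if p = c₁ then 1 else 0) (fun p => if p = c₂ then 1 else 0)
      (dressedWeight μ γ₁ γ₂ β₁ β₂ n c₁ c₂) j (q j)) * bulkFactor μ γ₁ e (fun j => (q j).2)

/-- The contribution of the coupling `J_e` to the averaged energy. -/
theorem sum_path_eq_sum_core {n : ℕ} (e : Pairs n) :
    ∑ q : Fin n → SpinPath,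
        (∏ j, if j = e.1.1 ∨ j = e.1.2 then coreWeight β₁ β₂ (q j) else bulkWeight β₁ β₂ (q j)) *
        (charMoment μ (phase γ₁ γ₂ (q e.1.1) (q e.1.2) / Real.sqrt n) *
          ∏ e' ∈ Finset.univ.erase e,
            charFun μ (phase γ₁ γ₂ (q e'.1.1) (q e'.1.2) / Real.sqrt n)) =
      ∑ c₁, ∑ c₂, coreWeight β₁ β₂ c₁ * coreWeight β₁ β₂ c₂ *
        charMoment μ (phase γ₁ γ₂ c₁ c₂ / Real.sqrt n) * bulkSum μ γ₁ γ₂ β₁ β₂ e c₁ c₂ := by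
  have key : ∀ q : Fin n → SpinPath,
      (∏ j ∈ bulk e, bulkWeight β₁ β₂ (q j)) *
        ∏ e' : Pairs n with e'.1.1 ∈ bulk e ∧ e'.1.2 ∈ bulk e,
          charFun μ (phase γ₁ γ₂ (q e'.1.1) (q e'.1.2) / Real.sqrt n) =
      (∏ j ∈ bulk e, bulkWeight β₁ β₂ (q j)) * bulkFactor μ γ₁ e (fun j => (q j).2) := by
    intro q
    -- If the middle spins disagree at some bulk qubit, both sides vanish.
    by_cases h : ∀ j ∈ bulk e, (q j).1.1 = (q j).1.2
    · congr 1
      refine Finset.prod_congr rfl fun e' he' => ?_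
      rw [Finset.mem_filter] at he'
      rw [phase_eq_layerPhase γ₁ γ₂ (h _ he'.2.1) (h _ he'.2.2)]
    · push Not at h
      obtain ⟨j, hj, hne⟩ := h
      rw [Finset.prod_eq_zero hj (by rw [bulkWeight_eq, if_neg hne]), zero_mul, zero_mul]
  have hsite : ∀ q : Fin n → SpinPath,
      (∏ j, if j = e.1.1 ∨ j = e.1.2 then coreWeight β₁ β₂ (q j) else bulkWeight β₁ β₂ (q j)) =
      coreWeight β₁ β₂ (q e.1.1) * coreWeight β₁ β₂ (q e.1.2) *
        ∏ j ∈ bulk e, bulkWeight β₁ β₂ (q j) := by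
    intro q
    rw [prod_eq_mul_prod_bulk e]
    simp only [true_or, or_true, if_true]
    congr 1
    refine Finset.prod_congr rfl fun j hj => ?_
    rw [mem_bulk] at hj
    simp [hj]
  simp only [bulkSum, Finset.mul_sum]
  conv_rhs =>
    enter [2, c₁]
    rw [Finset.sum_comm]
  rw [Finset.sum_comm]
  refine Finset.sum_congr rfl fun q _ => ?_
  rw [Finset.sum_eq_single (q e.1.1), Finset.sum_eq_single (q e.1.2)]
  · rw [prod_siteFun, if_pos rfl, if_pos rfl, hsite,
      prod_pairs_erase (F := fun j k => charFun μ (phase γ₁ γ₂ (q j) (q k) / Real.sqrt n))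
        (fun j k => by rw [phase_comm])]
    simp only [dressedWeight]
    rw [Finset.prod_mul_distrib (f := fun j => bulkWeight β₁ β₂ (q j))]
    linear_combination (coreWeight β₁ β₂ (q e.1.1) * coreWeight β₁ β₂ (q e.1.2) *
      charMoment μ (phase γ₁ γ₂ (q e.1.1) (q e.1.2) / Real.sqrt n) *
      ∏ k ∈ bulk e, charFun μ (phase γ₁ γ₂ (q e.1.1) (q k) / Real.sqrt n) *
        charFun μ (phase γ₁ γ₂ (q e.1.2) (q k) / Real.sqrt n)) * key q
  · intro c _ hc
    rw [prod_siteFun, if_neg (Ne.symm hc)]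
    ring
  · simp
  · intro c _ hc
    refine Finset.sum_eq_zero fun c' _ => ?_
    rw [prod_siteFun, if_neg (Ne.symm hc)]
    ring
  · simp

/-- The weight of the initial bra and ket spins of a bulk qubit. -/
noncomputable def layerWeight (c₁ c₂ : SpinPath) (b : ℤˣ × ℤˣ) : ℂ :=
  ∑ m, dressedWeight μ γ₁ γ₂ β₁ β₂ n c₁ c₂ (m, b)

theorem sum_ite_mk_eq (c : SpinPath) (b : ℤˣ × ℤˣ) :
    ∑ m, (if ((m, b) : SpinPath) = c then (1 : ℂ) else 0) = if b = c.2 then 1 else 0 := by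
  obtain ⟨c, c'⟩ := c
  simp only [Prod.mk.injEq, ite_and, Finset.sum_ite_eq', Finset.mem_univ, if_true]

theorem bulkSum_eq {n : ℕ} (e : Pairs n) (c₁ c₂ : SpinPath) :
    bulkSum μ γ₁ γ₂ β₁ β₂ e c₁ c₂ = ∑ b : Fin n → ℤˣ × ℤˣ,
      (∏ j, siteFun e (fun p => if p = c₁.2 then 1 else 0) (fun p => if p = c₂.2 then 1 else 0)
        (layerWeight μ γ₁ γ₂ β₁ β₂ n c₁ c₂) j (b j)) * bulkFactor μ γ₁ e b := by
  rw [bulkSum, sum_prodMk_eq (fun (x y : Fin n → ℤˣ × ℤˣ) =>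
    (∏ j, siteFun e (fun p => if p = c₁ then 1 else 0) (fun p => if p = c₂ then 1 else 0)
      (dressedWeight μ γ₁ γ₂ β₁ β₂ n c₁ c₂) j ((x j, y j) : SpinPath)) * bulkFactor μ γ₁ e y),
    Finset.sum_comm]
  refine Finset.sum_congr rfl fun b _ => ?_
  rw [← Finset.sum_mul, ← Fintype.prod_sum (fun j m => siteFun e (fun p => if p = c₁ then 1 else 0)
    (fun p => if p = c₂ then 1 else 0) (dressedWeight μ γ₁ γ₂ β₁ β₂ n c₁ c₂) j
      ((m, b j) : SpinPath))]
  congr 1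
  refine Finset.prod_congr rfl fun j _ => ?_
  simp only [siteFun]
  split_ifs
  · exact sum_ite_mk_eq _ _
  · exact sum_ite_mk_eq _ _
  · rfl

/-- The averaged weight of a bulk qubit whose bra and ket spins disagree initially is damped by
`r`. -/
noncomputable def damping (r : ℝ) (b : ℤˣ × ℤˣ) : ℝ := if b.1 = b.2 then 1 else r

/-- Apply `norm_prod_bulk_sub_le` with S the bulk qubits whose initial spins disagree and g = 2γ₁².
Main term and error factor 4^|S| are both products over qubits, so both sums factorise into powers;
n - 2 is the size of the bulk. -/
theorem norm_bulkSum_sub_le [IsProbabilityMeasure μ] {n : ℕ} (e : Pairs n) (c₁ c₂ : SpinPath) {δ : ℝ}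
    (h1 : ‖charFun μ (2 * γ₁ / Real.sqrt n) - Real.exp (-(2 * γ₁ ^ 2 / n))‖ ≤ δ)
    (h2 : ‖charFun μ (-(2 * γ₁) / Real.sqrt n) - Real.exp (-(2 * γ₁ ^ 2 / n))‖ ≤ δ) :
    ‖bulkSum μ γ₁ γ₂ β₁ β₂ e c₁ c₂ - (∑ b, layerWeight μ γ₁ γ₂ β₁ β₂ n c₁ c₂ b *
        damping (Real.exp (-(2 * γ₁ ^ 2))) b) ^ (n - 2)‖ ≤
      (n * δ + 3 * (2 * γ₁ ^ 2 / n)) *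
        (∑ b, ‖layerWeight μ γ₁ γ₂ β₁ β₂ n c₁ c₂ b‖ * damping 4 b) ^ (n - 2) := by
  have hdamp : ∀ (r : ℝ) (b : Fin n → ℤˣ × ℤˣ), ∏ j ∈ bulk e, damping r (b j) =
      r ^ ((bulk e).filter fun j => (b j).1 ≠ (b j).2).card := by
    intro r b
    rw [← Finset.prod_const, Finset.prod_filter]
    refine Finset.prod_congr rfl fun j _ => ?_
    by_cases h : (b j).1 = (b j).2 <;> simp [damping, h]
  have hbound : ∀ b : Fin n → ℤˣ × ℤˣ, ‖bulkFactor μ γ₁ e b -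
      ((∏ j ∈ bulk e, damping (Real.exp (-(2 * γ₁ ^ 2))) (b j) : ℝ) : ℂ)‖ ≤
      (n * δ + 3 * (2 * γ₁ ^ 2 / n)) * ∏ j ∈ bulk e, damping 4 (b j) := by
    intro b
    rw [hdamp, hdamp, Complex.ofReal_pow]
    refine norm_prod_bulk_sub_le e
      (f := fun j k => charFun μ (layerPhase γ₁ (b j) (b k) / Real.sqrt n))
      (fun j k => by rw [layerPhase_comm]) (fun j k => norm_charFun_le_one _)
      (Finset.filter_subset _ _) ?_ (by positivity) ?_ ((norm_nonneg _).trans h1)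
    · intro j hj k hk hjk
      simp only [Finset.mem_filter, hj, hk, true_and, ne_eq, not_iff_not] at hjk
      rw [layerPhase_eq_zero γ₁ hjk, zero_div, charFun_zero]
      simp
    · intro j hj k hk
      simp only [Finset.mem_filter, Finset.mem_sdiff, not_and, not_not] at hj hk
      rcases layerPhase_eq_or γ₁ hj.2 (hk.2 hk.1) with h | h <;> rw [h]
      · exact h1
      · exact h2
  have hsum : (∑ b, layerWeight μ γ₁ γ₂ β₁ β₂ n c₁ c₂ b *
        damping (Real.exp (-(2 * γ₁ ^ 2))) b) ^ (n - 2) = ∑ b : Fin n → ℤˣ × ℤˣ,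
      (∏ j, siteFun e (fun p => if p = c₁.2 then 1 else 0) (fun p => if p = c₂.2 then 1 else 0)
        (layerWeight μ γ₁ γ₂ β₁ β₂ n c₁ c₂) j (b j)) *
      ((∏ j ∈ bulk e, damping (Real.exp (-(2 * γ₁ ^ 2))) (b j) : ℝ) : ℂ) := by
    have h := sum_prod_siteFun e (fun p : ℤˣ × ℤˣ => if p = c₁.2 then (1 : ℂ) else 0)
      (fun p => if p = c₂.2 then 1 else 0) (fun b => layerWeight μ γ₁ γ₂ β₁ β₂ n c₁ c₂ b *
        damping (Real.exp (-(2 * γ₁ ^ 2))) b)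
    simp only [Finset.sum_ite_eq', Finset.mem_univ, if_true, one_mul] at h
    rw [← h]
    refine Finset.sum_congr rfl fun b _ => ?_
    rw [prod_siteFun, prod_siteFun, Finset.prod_mul_distrib, Complex.ofReal_prod, mul_assoc _ (∏ _ ∈ _, _)]
  have hsum' : (∑ b, ‖layerWeight μ γ₁ γ₂ β₁ β₂ n c₁ c₂ b‖ * damping 4 b) ^ (n - 2) =
      ∑ b : Fin n → ℤˣ × ℤˣ, ‖∏ j, siteFun e (fun p => if p = c₁.2 then (1 : ℂ) else 0)
        (fun p => if p = c₂.2 then 1 else 0)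
        (layerWeight μ γ₁ γ₂ β₁ β₂ n c₁ c₂) j (b j)‖ * ∏ j ∈ bulk e, damping 4 (b j) := by
    have h := sum_prod_siteFun e (fun p : ℤˣ × ℤˣ => if p = c₁.2 then (1 : ℝ) else 0)
      (fun p => if p = c₂.2 then 1 else 0)
      (fun b => ‖layerWeight μ γ₁ γ₂ β₁ β₂ n c₁ c₂ b‖ * damping 4 b)
    simp only [Finset.sum_ite_eq', Finset.mem_univ, if_true, one_mul] at h
    rw [← h]
    refine Finset.sum_congr rfl fun b _ => ?_
    rw [prod_siteFun, prod_siteFun, Finset.prod_mul_distrib, norm_mul, norm_mul, norm_prod,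
      mul_assoc _ (∏ _ ∈ _, _)]
    congr 2 <;> split_ifs <;> simp
  rw [hsum, hsum', bulkSum_eq, ← Finset.sum_sub_distrib, Finset.mul_sum]
  refine (norm_sum_le _ _).trans (Finset.sum_le_sum fun b _ => ?_)
  rw [← mul_sub, norm_mul, mul_left_comm]
  exact mul_le_mul_of_nonneg_left (hbound b) (norm_nonneg _)

end

/-! ### The limiting path weights and the closed formula -/

section
variable (γ₁ γ₂ β₁ β₂ : ℝ)

/-- The limiting logarithm of the bulk contribution of a path at a measured qubit. -/
noncomputable def pathExponent (c : SpinPath) : ℂ :=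
  ∑ q, bulkWeight β₁ β₂ q * damping (Real.exp (-(2 * γ₁ ^ 2))) q.2 *
    (-((phase γ₁ γ₂ c q : ℂ) ^ 2 / 2))

theorem sum_units_int {M : Type*} [AddCommMonoid M] (f : ℤˣ → M) : ∑ z, f z = f 1 + f (-1) := by
  rw [show (Finset.univ : Finset ℤˣ) = {1, -1} from rfl, Finset.sum_pair (by decide)]

theorem spinVal_one : spinVal 1 = 1 := by simp [spinVal]

theorem spinVal_neg_one : spinVal (-1) = -1 := by simp [spinVal]

theorem kern_one_one (β : ℝ) : kern β 1 1 = Real.cos β := by simp [kern]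

theorem kern_neg_neg (β : ℝ) : kern β (-1) (-1) = Real.cos β := by simp [kern]

theorem kern_one_neg (β : ℝ) : kern β 1 (-1) = -(Complex.I * Real.sin β) :=
  if_neg (by decide)

theorem kern_neg_one (β : ℝ) : kern β (-1) 1 = -(Complex.I * Real.sin β) :=
  if_neg (by decide)

/-- Bulk paths with a = a' have weights cos²β₁/2 and sin²β₁/2 and give the real part, whose cross
term leads to Ω. Those with a ≠ a' have weights ±(i/2) sin β₁ cos β₁ summing to zero, so only the
cross term of the squared phase survives, damped by exp(-2γ₁²); it leads to Λ. -/
theorem pathExponent_eq (c : SpinPath) : pathExponent γ₁ γ₂ β₁ β₂ c =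
    ((-γ₁ ^ 2 * (1 - spinVal c.2.1 * spinVal c.2.2) - γ₂ ^ 2 * (1 - spinVal c.1.1 * spinVal c.1.2) -
      γ₁ * γ₂ * Real.cos (2 * β₁) * (spinVal c.2.2 - spinVal c.2.1) *
        (spinVal c.1.2 - spinVal c.1.1) : ℝ) : ℂ) +
    Complex.I * ((Real.exp (-(2 * γ₁ ^ 2)) * Real.sin (2 * β₁) * γ₁ * γ₂ *
      (spinVal c.2.1 + spinVal c.2.2) * (spinVal c.1.2 - spinVal c.1.1) : ℝ) : ℂ) := by
  have h : ((Real.cos β₁ : ℂ)) ^ 2 + (Real.sin β₁ : ℂ) ^ 2 = 1 := by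
    exact_mod_cast Real.cos_sq_add_sin_sq β₁
  have h1 : ((1 : ℤˣ) = -1) = False := eq_false (by decide)
  have h2 : ((-1 : ℤˣ) = 1) = False := eq_false (by decide)
  rw [Real.cos_two_mul', Real.sin_two_mul]
  obtain ⟨⟨m, m'⟩, ⟨a, a'⟩⟩ := c
  simp only [pathExponent, Fintype.sum_prod_type, sum_units_int, bulkWeight_eq, damping, phase,
    h1, h2, if_true, if_false, zero_mul, add_zero, zero_add, kern_one_one, kern_neg_neg,
    kern_one_neg, kern_neg_one, spinVal_one, spinVal_neg_one, map_neg, map_mul, Complex.conj_I,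
    Complex.conj_ofReal]
  have hsq : ∀ z : ℤˣ, (spinVal z : ℂ) ^ 2 = 1 := by
    intro z
    rcases Int.units_eq_one_or z with rfl | rfl <;> simp [spinVal]
  generalize Real.cos β₁ = x at h ⊢
  generalize Real.sin β₁ = y at h ⊢
  push_cast
  linear_combination (-(1 / 2) * (γ₁ ^ 2 * (spinVal a' - spinVal a : ℂ) ^ 2 +
      γ₂ ^ 2 * (spinVal m' - spinVal m : ℂ) ^ 2)) * h +
    ((y : ℂ) ^ 2 / 2 * (γ₁ * (spinVal a' - spinVal a : ℂ) -
      γ₂ * (spinVal m' - spinVal m : ℂ)) ^ 2) * Complex.I_sq -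
    γ₁ ^ 2 / 2 * (hsq a + hsq a') - γ₂ ^ 2 / 2 * (hsq m + hsq m')

/-- The total weight of a path at a measured qubit in the limit of many qubits. -/
noncomputable def limitWeight (c : SpinPath) : ℂ :=
  coreWeight β₁ β₂ c * Complex.exp (pathExponent γ₁ γ₂ β₁ β₂ c)

theorem exp_pathExponent_diag_diag (m a : ℤˣ) :
    Complex.exp (pathExponent γ₁ γ₂ β₁ β₂ ((m, m), (a, a))) = 1 := by
  rw [pathExponent_eq]
  rcases Int.units_eq_one_or m with rfl | rfl <;> rcases Int.units_eq_one_or a with rfl | rfl <;>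
  simp [spinVal]

theorem exp_pathExponent_diag_neg (m a : ℤˣ) :
    Complex.exp (pathExponent γ₁ γ₂ β₁ β₂ ((m, m), (a, -a))) = Real.exp (-2 * γ₁ ^ 2) := by
  rw [pathExponent_eq, Complex.ofReal_exp]
  rcases Int.units_eq_one_or m with rfl | rfl <;> rcases Int.units_eq_one_or a with rfl | rfl <;>
  simp only [neg_neg, spinVal_one, spinVal_neg_one] <;> congr 1 <;> push_cast <;> ring

theorem exp_pathExponent_neg_diag (m a : ℤˣ) :
    Complex.exp (pathExponent γ₁ γ₂ β₁ β₂ ((m, -m), (a, a))) =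
      Real.exp (-2 * γ₂ ^ 2) * (Real.cos (Lam γ₁ γ₂ β₁) -
        spinVal m * spinVal a * Real.sin (Lam γ₁ γ₂ β₁) * Complex.I) := by
  have h : (Real.cos (Lam γ₁ γ₂ β₁) - spinVal m * spinVal a * Real.sin (Lam γ₁ γ₂ β₁) * Complex.I : ℂ)
      = Complex.exp (-(spinVal m * spinVal a * Lam γ₁ γ₂ β₁ : ℝ) * Complex.I) := by
    rw [Complex.exp_mul_I, Complex.cos_neg, Complex.sin_neg, ← Complex.ofReal_cos,
      ← Complex.ofReal_sin]
    rcases Int.units_eq_one_or m with rfl | rfl <;> rcases Int.units_eq_one_or a with rfl | rfl <;>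
    simp [spinVal, ← sub_eq_add_neg]
  rw [h, pathExponent_eq, Complex.ofReal_exp, ← Complex.exp_add, Lam]
  rcases Int.units_eq_one_or m with rfl | rfl <;> rcases Int.units_eq_one_or a with rfl | rfl <;>
  simp only [neg_neg, spinVal_one, spinVal_neg_one] <;> congr 1 <;> push_cast <;> ring_nf

theorem exp_pathExponent_neg_neg (m a : ℤˣ) :
    Complex.exp (pathExponent γ₁ γ₂ β₁ β₂ ((m, -m), (a, -a))) =
      Real.exp (-2 * (γ₁ ^ 2 + γ₂ ^ 2)) * (Real.cosh (Omg γ₁ γ₂ β₁) -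
        spinVal m * spinVal a * Real.sinh (Omg γ₁ γ₂ β₁)) := by
  have h : (Real.cosh (Omg γ₁ γ₂ β₁) - spinVal m * spinVal a * Real.sinh (Omg γ₁ γ₂ β₁) : ℂ) =
      Complex.exp (-(spinVal m * spinVal a * Omg γ₁ γ₂ β₁ : ℝ)) := by
    rw [← Complex.cosh_add_sinh, Complex.cosh_neg, Complex.sinh_neg]
    rcases Int.units_eq_one_or m with rfl | rfl <;> rcases Int.units_eq_one_or a with rfl | rfl <;>
    simp only [spinVal_one, spinVal_neg_one] <;> push_cast <;> simp [← sub_eq_add_neg]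
  rw [h, pathExponent_eq, Complex.ofReal_exp, ← Complex.exp_add, Omg]
  rcases Int.units_eq_one_or m with rfl | rfl <;> rcases Int.units_eq_one_or a with rfl | rfl <;>
  simp only [neg_neg, spinVal_one, spinVal_neg_one] <;> congr 1 <;> push_cast <;> ring

theorem coreWeight_diag (m a a' : ℤˣ) : coreWeight β₁ β₂ ((m, m), (a, a')) =
    spinVal m * Real.cos (2 * β₂) / 2 * (kern β₁ m a * starRingEnd ℂ (kern β₁ m a')) := by
  rw [Real.cos_two_mul']
  simp only [coreWeight, pathAmp, sum_units_int, spinVal_one, spinVal_neg_one]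
  rcases Int.units_eq_one_or m with rfl | rfl <;>
  simp only [kern_one_one, kern_neg_neg, kern_one_neg, kern_neg_one, spinVal_one, spinVal_neg_one,
    map_neg, map_mul, Complex.conj_I, Complex.conj_ofReal] <;> push_cast
  · linear_combination (1 / 2 * (kern β₁ 1 a * starRingEnd ℂ (kern β₁ 1 a')) *
      Complex.sin β₂ ^ 2) * Complex.I_sq
  · linear_combination (-1 / 2 * (kern β₁ (-1) a * starRingEnd ℂ (kern β₁ (-1) a')) *
      Complex.sin β₂ ^ 2) * Complex.I_sq

theorem coreWeight_neg (m a a' : ℤˣ) : coreWeight β₁ β₂ ((m, -m), (a, a')) =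
    spinVal m * Complex.I * Real.sin (2 * β₂) / 2 *
      (kern β₁ m a * starRingEnd ℂ (kern β₁ (-m) a')) := by
  rw [Real.sin_two_mul]
  simp only [coreWeight, pathAmp, sum_units_int, spinVal_one, spinVal_neg_one]
  rcases Int.units_eq_one_or m with rfl | rfl <;>
  simp only [neg_neg, kern_one_one, kern_neg_neg, kern_one_neg, kern_neg_one, spinVal_one,
    spinVal_neg_one, map_neg, map_mul, Complex.conj_I, Complex.conj_ofReal] <;> push_cast <;> ring

theorem sum_spinPath_cases (f : SpinPath → ℂ) : ∑ c, f c = ∑ m, ∑ a,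
    (f ((m, m), (a, a)) + f ((m, m), (a, -a)) + f ((m, -m), (a, a)) + f ((m, -m), (a, -a))) := by
  simp only [Fintype.sum_prod_type, sum_units_int, neg_neg]
  ring

/-- The sum of the limiting path weights against a function of the path, written out. -/
theorem sum_limitWeight_mul (f : SpinPath → ℂ) :
    ∑ c, limitWeight γ₁ γ₂ β₁ β₂ c * f c = ∑ m, ∑ a,
      (spinVal m * Real.cos (2 * β₂) / 2 * (kern β₁ m a * starRingEnd ℂ (kern β₁ m a)) *
          f ((m, m), (a, a)) +
        spinVal m * Real.cos (2 * β₂) / 2 * (kern β₁ m a * starRingEnd ℂ (kern β₁ m (-a))) *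
          Real.exp (-2 * γ₁ ^ 2) * f ((m, m), (a, -a)) +
        spinVal m * Complex.I * Real.sin (2 * β₂) / 2 *
          (kern β₁ m a * starRingEnd ℂ (kern β₁ (-m) a)) *
          (Real.exp (-2 * γ₂ ^ 2) * (Real.cos (Lam γ₁ γ₂ β₁) -
            spinVal m * spinVal a * Real.sin (Lam γ₁ γ₂ β₁) * Complex.I)) * f ((m, -m), (a, a)) +
        spinVal m * Complex.I * Real.sin (2 * β₂) / 2 *
          (kern β₁ m a * starRingEnd ℂ (kern β₁ (-m) (-a))) *
          (Real.exp (-2 * (γ₁ ^ 2 + γ₂ ^ 2)) * (Real.cosh (Omg γ₁ γ₂ β₁) -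
            spinVal m * spinVal a * Real.sinh (Omg γ₁ γ₂ β₁))) * f ((m, -m), (a, -a))) := by
  rw [sum_spinPath_cases]
  simp only [limitWeight, exp_pathExponent_diag_diag, exp_pathExponent_diag_neg,
    exp_pathExponent_neg_diag, exp_pathExponent_neg_neg, coreWeight_diag, coreWeight_neg, mul_one]

/-- Only paths with a' = a contribute; the terms in sin Λ cancel in the sum over spins. -/
theorem sum_limitWeight_layer_add :
    ∑ c, limitWeight γ₁ γ₂ β₁ β₂ c * (spinVal c.2.2 + spinVal c.2.1) =
      2 * (Real.cos (2 * β₁) * Real.cos (2 * β₂) - Real.exp (-2 * γ₂ ^ 2) * Real.sin (2 * β₁) *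
        Real.sin (2 * β₂) * Real.cos (Lam γ₁ γ₂ β₁)) := by
  rw [sum_limitWeight_mul, Real.cos_two_mul' β₁, Real.sin_two_mul β₁]
  generalize Real.cos (2 * β₂) = p, Real.sin (2 * β₂) = q, Real.exp (-2 * γ₂ ^ 2) = E₂,
    Real.cos (Lam γ₁ γ₂ β₁) = u
  simp only [sum_units_int, neg_neg, kern_one_one, kern_neg_neg, kern_one_neg, kern_neg_one,
    spinVal_one, spinVal_neg_one, map_neg, map_mul, Complex.conj_I, Complex.conj_ofReal]
  generalize Real.cos β₁ = x, Real.sin β₁ = y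
  push_cast
  linear_combination (2 * p * y ^ 2 + 4 * q * y * x * E₂ * u : ℂ) * Complex.I_sq

theorem sum_limitWeight_layer_sub :
    ∑ c, limitWeight γ₁ γ₂ β₁ β₂ c * (spinVal c.2.2 - spinVal c.2.1) =
      -2 * Complex.I * (Real.exp (-2 * γ₁ ^ 2) * Real.sin (2 * β₁) * Real.cos (2 * β₂) +
        Real.exp (-2 * (γ₁ ^ 2 + γ₂ ^ 2)) * Real.sin (2 * β₂) *
          (Real.cos (2 * β₁) * Real.cosh (Omg γ₁ γ₂ β₁) - Real.sinh (Omg γ₁ γ₂ β₁))) := by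
  have h : ((Real.cos β₁ : ℂ)) ^ 2 + (Real.sin β₁ : ℂ) ^ 2 = 1 := by
    exact_mod_cast Real.cos_sq_add_sin_sq β₁
  rw [sum_limitWeight_mul, Real.cos_two_mul' β₁, Real.sin_two_mul β₁]
  generalize Real.cos (2 * β₂) = p, Real.sin (2 * β₂) = q, Real.exp (-2 * γ₁ ^ 2) = E₁,
    Real.exp (-2 * (γ₁ ^ 2 + γ₂ ^ 2)) = E, Real.cosh (Omg γ₁ γ₂ β₁) = u,
    Real.sinh (Omg γ₁ γ₂ β₁) = v
  simp only [sum_units_int, neg_neg, kern_one_one, kern_neg_neg, kern_one_neg, kern_neg_one,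
    spinVal_one, spinVal_neg_one, map_neg, map_mul, Complex.conj_I, Complex.conj_ofReal]
  generalize Real.cos β₁ = x at h ⊢
  generalize Real.sin β₁ = y at h ⊢
  push_cast
  linear_combination (-2 * Complex.I * q * E * y ^ 2 * (u + v) : ℂ) * Complex.I_sq +
    (2 * Complex.I * q * E * v : ℂ) * h

/-- Only paths with m' = m contribute, and those with a' = -a cancel in pairs, which removes all
dependence on the first layer. -/
theorem sum_limitWeight_mid_add :
    ∑ c, limitWeight γ₁ γ₂ β₁ β₂ c * (spinVal c.1.2 + spinVal c.1.1) =
      2 * Real.cos (2 * β₂) := by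
  have h : ((Real.cos β₁ : ℂ)) ^ 2 + (Real.sin β₁ : ℂ) ^ 2 = 1 := by
    exact_mod_cast Real.cos_sq_add_sin_sq β₁
  rw [sum_limitWeight_mul]
  generalize Real.cos (2 * β₂) = p
  simp only [sum_units_int, neg_neg, kern_one_one, kern_neg_neg, kern_one_neg, kern_neg_one,
    spinVal_one, spinVal_neg_one, map_neg, map_mul, Complex.conj_I, Complex.conj_ofReal]
  generalize Real.cos β₁ = x at h ⊢
  generalize Real.sin β₁ = y at h ⊢
  push_cast
  linear_combination (-2 * p * y ^ 2 : ℂ) * Complex.I_sq + (2 * p : ℂ) * h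

theorem sum_limitWeight_mid_sub :
    ∑ c, limitWeight γ₁ γ₂ β₁ β₂ c * (spinVal c.1.2 - spinVal c.1.1) =
      -2 * Complex.I * Real.sin (2 * β₂) * (Real.exp (-2 * (γ₁ ^ 2 + γ₂ ^ 2)) *
        (Real.cosh (Omg γ₁ γ₂ β₁) - Real.cos (2 * β₁) * Real.sinh (Omg γ₁ γ₂ β₁)) +
        Real.exp (-2 * γ₂ ^ 2) * Real.sin (2 * β₁) * Real.sin (Lam γ₁ γ₂ β₁)) := by
  have h : ((Real.cos β₁ : ℂ)) ^ 2 + (Real.sin β₁ : ℂ) ^ 2 = 1 := by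
    exact_mod_cast Real.cos_sq_add_sin_sq β₁
  rw [sum_limitWeight_mul, Real.cos_two_mul' β₁, Real.sin_two_mul β₁]
  generalize Real.sin (2 * β₂) = q, Real.exp (-2 * γ₂ ^ 2) = E₂,
    Real.exp (-2 * (γ₁ ^ 2 + γ₂ ^ 2)) = E, Real.cosh (Omg γ₁ γ₂ β₁) = u,
    Real.sinh (Omg γ₁ γ₂ β₁) = v, Real.sin (Lam γ₁ γ₂ β₁) = w
  simp only [sum_units_int, neg_neg, kern_one_one, kern_neg_neg, kern_one_neg, kern_neg_one,
    spinVal_one, spinVal_neg_one, map_neg, map_mul, Complex.conj_I, Complex.conj_ofReal]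
  generalize Real.cos β₁ = x at h ⊢
  generalize Real.sin β₁ = y at h ⊢
  push_cast
  linear_combination (-Complex.I * q * (-4 * y * x * E₂ * w - 2 * E * y ^ 2 * (u + v)) : ℂ) *
    Complex.I_sq + (-2 * Complex.I * q * E * u : ℂ) * h

/-- Evaluation of the limiting two-path sum. -/
theorem sum_limitWeight_phase :
    ∑ c₁, ∑ c₂, limitWeight γ₁ γ₂ β₁ β₂ c₁ * limitWeight γ₁ γ₂ β₁ β₂ c₂ *
        (Complex.I * phase γ₁ γ₂ c₁ c₂) / 2 =
      (((γ₁ * Gamma1 γ₁ γ₂ β₁ β₂ + γ₂ * Gamma2 γ₁ γ₂ β₁ β₂) *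
        Real.exp (-2 * (γ₁ ^ 2 + γ₂ ^ 2)) : ℝ) : ℂ) := by
  have hbil : ∀ f g : SpinPath → ℂ, (∑ c, limitWeight γ₁ γ₂ β₁ β₂ c * f c) *
      (∑ c, limitWeight γ₁ γ₂ β₁ β₂ c * g c) = ∑ c₁, ∑ c₂, limitWeight γ₁ γ₂ β₁ β₂ c₁ *
        limitWeight γ₁ γ₂ β₁ β₂ c₂ * (f c₁ * g c₂) := by
    intro f g
    rw [Finset.sum_mul_sum]
    refine Finset.sum_congr rfl fun _ _ => Finset.sum_congr rfl fun _ _ => ?_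
    ring
  -- In each layer the phase is bra product minus ket product, so the double sum is a difference of
  -- two squares, factored as sum times difference.
  have h1 : ∑ c₁, ∑ c₂, limitWeight γ₁ γ₂ β₁ β₂ c₁ * limitWeight γ₁ γ₂ β₁ β₂ c₂ *
        (Complex.I * phase γ₁ γ₂ c₁ c₂) / 2 = Complex.I / 2 * (
      γ₁ * ((∑ c, limitWeight γ₁ γ₂ β₁ β₂ c * (spinVal c.2.2 + spinVal c.2.1)) *
        (∑ c, limitWeight γ₁ γ₂ β₁ β₂ c * (spinVal c.2.2 - spinVal c.2.1))) +
      γ₂ * ((∑ c, limitWeight γ₁ γ₂ β₁ β₂ c * (spinVal c.1.2 + spinVal c.1.1)) *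
        (∑ c, limitWeight γ₁ γ₂ β₁ β₂ c * (spinVal c.1.2 - spinVal c.1.1)))) := by
    have hadd : ∀ f g : SpinPath → ℂ, ∑ c, limitWeight γ₁ γ₂ β₁ β₂ c * (f c + g c) =
        ∑ c, limitWeight γ₁ γ₂ β₁ β₂ c * f c + ∑ c, limitWeight γ₁ γ₂ β₁ β₂ c * g c := by
      intro f g
      simp_rw [mul_add, Finset.sum_add_distrib]
    have hsub : ∀ f g : SpinPath → ℂ, ∑ c, limitWeight γ₁ γ₂ β₁ β₂ c * (f c - g c) =
        ∑ c, limitWeight γ₁ γ₂ β₁ β₂ c * f c - ∑ c, limitWeight γ₁ γ₂ β₁ β₂ c * g c := by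
      intro f g
      simp_rw [mul_sub, Finset.sum_sub_distrib]
    rw [hadd, hsub, hadd, hsub, ← mul_self_sub_mul_self, ← mul_self_sub_mul_self, hbil, hbil, hbil,
      hbil]
    simp only [Finset.mul_sum, ← Finset.sum_add_distrib, ← Finset.sum_sub_distrib]
    refine Finset.sum_congr rfl fun _ _ => Finset.sum_congr rfl fun _ _ => ?_
    rw [phase]
    push_cast
    ring
  have e1 : Real.exp (-2 * γ₁ ^ 2) =
      Real.exp (-2 * (γ₁ ^ 2 + γ₂ ^ 2)) * Real.exp (2 * γ₂ ^ 2) := by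
    rw [← Real.exp_add]
    congr 1
    ring
  have e2 : Real.exp (-2 * γ₂ ^ 2) =
      Real.exp (-2 * (γ₁ ^ 2 + γ₂ ^ 2)) * Real.exp (2 * γ₁ ^ 2) := by
    rw [← Real.exp_add]
    congr 1
    ring
  rw [h1, sum_limitWeight_layer_add, sum_limitWeight_layer_sub, sum_limitWeight_mid_add,
    sum_limitWeight_mid_sub, e1, Gamma1, Gamma2,
    show Real.sin (4 * β₂) = 2 * Real.sin (2 * β₂) * Real.cos (2 * β₂) by
      rw [← Real.sin_two_mul]; congr 1; ring]
  generalize Real.exp (-2 * (γ₁ ^ 2 + γ₂ ^ 2)) = E at e2 ⊢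
  generalize Real.exp (-2 * γ₂ ^ 2) = E₂ at e2 ⊢
  generalize Real.exp (2 * γ₂ ^ 2) = F₂
  generalize Real.exp (2 * γ₁ ^ 2) = F₁ at e2 ⊢
  generalize Real.cos (2 * β₁) = p₁, Real.sin (2 * β₁) = q₁, Real.cos (2 * β₂) = p₂,
    Real.sin (2 * β₂) = q₂, Real.cosh (Omg γ₁ γ₂ β₁) = ch, Real.sinh (Omg γ₁ γ₂ β₁) = sh,
    Real.cos (Lam γ₁ γ₂ β₁) = u, Real.sin (Lam γ₁ γ₂ β₁) = v
  have e3 : (E₂ : ℂ) = E * F₁ := by exact_mod_cast e2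
  push_cast
  linear_combination (-2 * γ₁ * (E * F₂ * q₁ * p₂ + E * q₂ * (p₁ * ch - sh)) *
      (p₁ * p₂ - E₂ * q₁ * q₂ * u) -
    2 * γ₂ * p₂ * q₂ * (E * (ch - p₁ * sh) + E₂ * q₁ * v) : ℂ) * Complex.I_sq +
    (2 * γ₂ * p₂ * q₂ * q₁ * v : ℂ) * e3

end

/-! ### The limit of many qubits -/

theorem tendsto_zero_of_tendsto_natCast_mul {g : ℕ → ℂ} {t : ℂ}
    (hg : Tendsto (fun n : ℕ => (n : ℂ) * g n) atTop (𝓝 t)) : Tendsto g atTop (𝓝 0) := by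
  have h := (tendsto_inv_atTop_nhds_zero_nat (𝕜 := ℂ)).mul hg
  rw [zero_mul] at h
  refine h.congr' ?_
  filter_upwards [eventually_ne_atTop 0] with n hn
  rw [inv_mul_cancel_left₀ (Nat.cast_ne_zero.2 hn)]

/-- Shifting the index by 2 removes the truncated subtraction; the resulting correction 2 g tends to
0. -/
theorem tendsto_one_add_pow_sub_two {g : ℕ → ℂ} {t : ℂ}
    (hg : Tendsto (fun n : ℕ => (n : ℂ) * g n) atTop (𝓝 t)) :
    Tendsto (fun n : ℕ => (1 + g n) ^ (n - 2)) atTop (𝓝 (Complex.exp t)) := by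
  rw [← tendsto_add_atTop_iff_nat 2]
  simp only [Nat.add_sub_cancel]
  refine Complex.tendsto_one_add_pow_exp_of_tendsto ?_
  have h1 := ((tendsto_add_atTop_iff_nat 2).2 hg).sub
    (((tendsto_add_atTop_iff_nat 2).2 (tendsto_zero_of_tendsto_natCast_mul hg)).const_mul 2)
  rw [mul_zero, sub_zero] at h1
  refine h1.congr fun n => ?_
  push_cast
  ring

theorem tendsto_natCast_mul_exp_sub_one (g : ℝ) :
    Tendsto (fun n : ℕ => (n : ℂ) * ((Real.exp (-(g / n)) : ℂ) - 1)) atTop (𝓝 (-g)) := by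
  have h : HasDerivAt (fun s : ℝ => Real.exp (-(g * s))) (-g) 0 := by
    have := (((hasDerivAt_id (0 : ℝ)).const_mul g).neg).exp
    simpa using this
  have h1 := h.tendsto_slope_zero_right.comp
    (tendsto_inv_atTop_nhdsGT_zero.comp (tendsto_natCast_atTop_atTop (R := ℝ)))
  have h2 := (Complex.continuous_ofReal.tendsto _).comp h1
  rw [Complex.ofReal_neg] at h2
  refine h2.congr fun n => ?_
  simp [div_eq_mul_inv]

theorem two_mul_card_pairs (n : ℕ) : 2 * Fintype.card (Pairs n) + n = n ^ 2 := by
  have h1 : Fintype.card (Pairs n) = ∑ i : Fin n, (Finset.Ioi i).card := by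
    rw [Fintype.card_subtype, Finset.card_filter, Fintype.sum_prod_type]
    refine Finset.sum_congr rfl fun i _ => ?_
    rw [← Finset.card_filter]
    congr 1
    ext j
    simp
  have h2 : Fintype.card (Pairs n) = ∑ i : Fin n, (Finset.Iio i).card := by
    rw [Fintype.card_subtype, Finset.card_filter, Fintype.sum_prod_type_right]
    refine Finset.sum_congr rfl fun i _ => ?_
    rw [← Finset.card_filter]
    congr 1
    ext j
    simp
  have h3 : ∑ i : Fin n, ((Finset.Ioi i).card + (Finset.Iio i).card + 1) = ∑ _i : Fin n, n := by
    refine Finset.sum_congr rfl fun i _ => ?_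
    rw [Fin.card_Ioi, Fin.card_Iio]
    omega
  rw [Finset.sum_add_distrib, Finset.sum_add_distrib, ← h1, ← h2] at h3
  simp at h3
  rw [pow_two]
  omega

theorem tendsto_card_pairs_div :
    Tendsto (fun n : ℕ => (Fintype.card (Pairs n) : ℂ) / (n : ℂ) ^ 2) atTop (𝓝 (1 / 2)) := by
  have h := ((tendsto_inv_atTop_nhds_zero_nat (𝕜 := ℂ)).const_sub 1).mul_const (1 / 2)
  rw [sub_zero, one_mul] at h
  refine h.congr' ?_
  filter_upwards [eventually_ne_atTop 0] with n hn
  have hn' : (n : ℂ) ≠ 0 := Nat.cast_ne_zero.2 hn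
  have h2 : 2 * (Fintype.card (Pairs n) : ℂ) + n = n ^ 2 := by
    exact_mod_cast two_mul_card_pairs n
  field_simp
  linear_combination -h2

section
variable {μ : Measure ℝ} [IsProbabilityMeasure μ]

/-- A bulk contribution's first-order change due to its coupling to two fixed paths. -/
noncomputable def layerLimit (γ₁ γ₂ β₁ β₂ : ℝ) (c₁ c₂ : SpinPath) (b : ℤˣ × ℤˣ) : ℂ :=
  ∑ m, bulkWeight β₁ β₂ (m, b) *
    (-(((phase γ₁ γ₂ c₁ (m, b) : ℂ) ^ 2 + (phase γ₁ γ₂ c₂ (m, b) : ℂ) ^ 2) / 2))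

theorem tendsto_layerWeight (hmean : ∫ x, x ∂μ = 0) (hvar : ∫ x, x ^ 2 ∂μ = 1)
    (γ₁ γ₂ β₁ β₂ : ℝ) (c₁ c₂ : SpinPath) (b : ℤˣ × ℤˣ) :
    Tendsto (fun n : ℕ => (n : ℂ) * (layerWeight μ γ₁ γ₂ β₁ β₂ n c₁ c₂ b -
      ∑ m, bulkWeight β₁ β₂ (m, b))) atTop (𝓝 (layerLimit γ₁ γ₂ β₁ β₂ c₁ c₂ b)) := by
  have h := tendsto_finsetSum Finset.univ fun m _ =>
    (tendsto_mul_charFun_mul_charFun_sub_one hmean hvar (phase γ₁ γ₂ c₁ (m, b))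
      (phase γ₁ γ₂ c₂ (m, b))).const_mul (bulkWeight β₁ β₂ (m, b))
  refine h.congr fun n => ?_
  rw [layerWeight, ← Finset.sum_sub_distrib, Finset.mul_sum]
  refine Finset.sum_congr rfl fun m _ => ?_
  rw [dressedWeight]
  ring

theorem sum_layerLimit_damping (γ₁ γ₂ β₁ β₂ : ℝ) (c₁ c₂ : SpinPath) :
    ∑ b, layerLimit γ₁ γ₂ β₁ β₂ c₁ c₂ b * damping (Real.exp (-(2 * γ₁ ^ 2))) b =
      pathExponent γ₁ γ₂ β₁ β₂ c₁ + pathExponent γ₁ γ₂ β₁ β₂ c₂ := by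
  rw [pathExponent, pathExponent, ← Finset.sum_add_distrib]
  refine Eq.trans (Finset.sum_congr rfl fun b _ => ?_) (Fintype.sum_prod_type_right _).symm
  rw [layerLimit, Finset.sum_mul]
  refine Finset.sum_congr rfl fun m _ => ?_
  ring

/-- The damping acts only where the total weight is zero, so the undressed one-qubit sum is exactly
1 for every `r`. -/
theorem sum_sum_bulkWeight_mul_damping (β₁ β₂ r : ℝ) :
    ∑ b, (∑ m, bulkWeight β₁ β₂ (m, b)) * (damping r b : ℂ) = 1 := by
  simp_rw [sum_bulkWeight, Fintype.sum_prod_type, damping]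
  rw [sum_units_int, sum_units_int, sum_units_int]
  norm_num [show ((1 : ℤˣ) = -1) = False from eq_false (by decide),
    show ((-1 : ℤˣ) = 1) = False from eq_false (by decide)]

theorem tendsto_sum_layerWeight_pow (hmean : ∫ x, x ∂μ = 0) (hvar : ∫ x, x ^ 2 ∂μ = 1)
    (γ₁ γ₂ β₁ β₂ : ℝ) (c₁ c₂ : SpinPath) :
    Tendsto (fun n : ℕ => (∑ b, layerWeight μ γ₁ γ₂ β₁ β₂ n c₁ c₂ b *
        (damping (Real.exp (-(2 * γ₁ ^ 2))) b : ℂ)) ^ (n - 2)) atTop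
      (𝓝 (Complex.exp (pathExponent γ₁ γ₂ β₁ β₂ c₁ + pathExponent γ₁ γ₂ β₁ β₂ c₂))) := by
  have h := tendsto_finsetSum Finset.univ fun b _ =>
    (tendsto_layerWeight hmean hvar γ₁ γ₂ β₁ β₂ c₁ c₂ b).mul_const
      (damping (Real.exp (-(2 * γ₁ ^ 2))) b : ℂ)
  rw [sum_layerLimit_damping] at h
  have h1 : Tendsto (fun n : ℕ => (n : ℂ) * (∑ b, layerWeight μ γ₁ γ₂ β₁ β₂ n c₁ c₂ b *
        (damping (Real.exp (-(2 * γ₁ ^ 2))) b : ℂ) - 1)) atTop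
      (𝓝 (pathExponent γ₁ γ₂ β₁ β₂ c₁ + pathExponent γ₁ γ₂ β₁ β₂ c₂)) := by
    refine h.congr fun n => ?_
    rw [← sum_sum_bulkWeight_mul_damping β₁ β₂ (Real.exp (-(2 * γ₁ ^ 2))),
      ← Finset.sum_sub_distrib, Finset.mul_sum]
    refine Finset.sum_congr rfl fun b _ => ?_
    ring
  refine (tendsto_one_add_pow_sub_two h1).congr fun n => ?_
  rw [add_sub_cancel]

theorem norm_layerWeight_diag_le (γ₁ γ₂ β₁ β₂ : ℝ) (n : ℕ) (c₁ c₂ : SpinPath) (a : ℤˣ) :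
    ‖layerWeight μ γ₁ γ₂ β₁ β₂ n c₁ c₂ (a, a)‖ ≤ 1 / 2 := by
  rw [layerWeight, ← sum_norm_bulkWeight β₁ β₂ a]
  refine (norm_sum_le _ _).trans (Finset.sum_le_sum fun m _ => ?_)
  rw [dressedWeight, norm_mul, norm_mul]
  exact mul_le_of_le_one_right (norm_nonneg _)
    (mul_le_one₀ (norm_charFun_le_one _) (norm_nonneg _) (norm_charFun_le_one _))

/-- The two diagonal weights have norm at most 1/2 each, and the off-diagonal ones are O(1/n), so
the base is at most 1 + O(1/n) despite the factor 4. -/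
theorem exists_sum_norm_layerWeight_pow_le (hmean : ∫ x, x ∂μ = 0) (hvar : ∫ x, x ^ 2 ∂μ = 1)
    (γ₁ γ₂ β₁ β₂ : ℝ) (c₁ c₂ : SpinPath) :
    ∃ K, ∀ᶠ n : ℕ in atTop, (∑ b, ‖layerWeight μ γ₁ γ₂ β₁ β₂ n c₁ c₂ b‖ * damping 4 b) ^ (n - 2)
      ≤ K := by
  have hneg : ∀ a : ℤˣ, a ≠ -a := by decide
  have ht : ∀ a : ℤˣ, Tendsto (fun n : ℕ => (n : ℂ) *
      ((‖layerWeight μ γ₁ γ₂ β₁ β₂ n c₁ c₂ (a, -a)‖ * 4 : ℝ) : ℂ)) atTop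
      (𝓝 ((‖layerLimit γ₁ γ₂ β₁ β₂ c₁ c₂ (a, -a)‖ * 4 : ℝ) : ℂ)) := by
    intro a
    have h := ((tendsto_layerWeight hmean hvar γ₁ γ₂ β₁ β₂ c₁ c₂ (a, -a)).norm.mul_const 4)
    have h1 := (Complex.continuous_ofReal.tendsto _).comp h
    refine h1.congr fun n => ?_
    rw [Function.comp, sum_bulkWeight, if_neg (hneg a), sub_zero, norm_mul, RCLike.norm_natCast]
    push_cast
    ring
  have h1 : Tendsto (fun n : ℕ => (n : ℂ) *
      ((∑ a, ‖layerWeight μ γ₁ γ₂ β₁ β₂ n c₁ c₂ (a, -a)‖ * 4 : ℝ) : ℂ)) atTop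
      (𝓝 (∑ a, ((‖layerLimit γ₁ γ₂ β₁ β₂ c₁ c₂ (a, -a)‖ * 4 : ℝ) : ℂ))) := by
    refine (tendsto_finsetSum Finset.univ fun a _ => ht a).congr fun n => ?_
    rw [Complex.ofReal_sum, Finset.mul_sum]
  have h2 := (tendsto_one_add_pow_sub_two h1).norm
  refine ⟨_, (h2.eventually_le_const (lt_add_one _)).mono fun n hn => le_trans ?_ hn⟩
  rw [norm_pow]
  refine pow_le_pow_left₀ ?_ ?_ _
  · refine Finset.sum_nonneg fun b _ => mul_nonneg (norm_nonneg _) ?_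
    rw [damping]
    split_ifs <;> norm_num
  · have hpos : (0 : ℝ) ≤ 1 + ∑ a, ‖layerWeight μ γ₁ γ₂ β₁ β₂ n c₁ c₂ (a, -a)‖ * 4 := by positivity
    rw [← Complex.ofReal_one, ← Complex.ofReal_add, Complex.norm_real, Real.norm_of_nonneg hpos]
    have hd1 := norm_layerWeight_diag_le (μ := μ) γ₁ γ₂ β₁ β₂ n c₁ c₂ 1
    have hd2 := norm_layerWeight_diag_le (μ := μ) γ₁ γ₂ β₁ β₂ n c₁ c₂ (-1)
    simp only [Fintype.sum_prod_type, sum_units_int, neg_neg, damping,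
      show ((1 : ℤˣ) = -1) = False from eq_false (by decide),
      show ((-1 : ℤˣ) = 1) = False from eq_false (by decide), if_true, if_false]
    linarith

/-- Both functions are 1 - t²/(2n) + o(1/n); this is the rate required of δ in
`norm_bulkSum_sub_le`. -/
theorem tendsto_natCast_mul_norm_charFun_sub (hmean : ∫ x, x ∂μ = 0) (hvar : ∫ x, x ^ 2 ∂μ = 1)
    (t : ℝ) : Tendsto (fun n : ℕ => (n : ℝ) *
      ‖charFun μ (t / Real.sqrt n) - Real.exp (-(t ^ 2 / 2 / n))‖) atTop (𝓝 0) := by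
  have h := ((tendsto_mul_charFun_sub_one hmean hvar t).sub
    (tendsto_natCast_mul_exp_sub_one (t ^ 2 / 2))).norm
  have h0 : ‖(-((t : ℂ) ^ 2 / 2) - -((t ^ 2 / 2 : ℝ) : ℂ))‖ = 0 := by
    push_cast
    simp
  rw [h0] at h
  refine h.congr fun n => ?_
  rw [← mul_sub, sub_sub_sub_cancel_right, norm_mul, RCLike.norm_natCast]

/-- The bulk sum converges uniformly over the choice of the measured pair. -/
theorem exists_norm_bulkSum_sub_le (hmean : ∫ x, x ∂μ = 0) (hvar : ∫ x, x ^ 2 ∂μ = 1)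
    (γ₁ γ₂ β₁ β₂ : ℝ) (c₁ c₂ : SpinPath) :
    ∃ η : ℕ → ℝ, Tendsto η atTop (𝓝 0) ∧ ∀ᶠ n : ℕ in atTop, ∀ e : Pairs n,
      ‖bulkSum μ γ₁ γ₂ β₁ β₂ e c₁ c₂ - Complex.exp (pathExponent γ₁ γ₂ β₁ β₂ c₁ +
        pathExponent γ₁ γ₂ β₁ β₂ c₂)‖ ≤ η n := by
  obtain ⟨K, hK⟩ := exists_sum_norm_layerWeight_pow_le hmean hvar γ₁ γ₂ β₁ β₂ c₁ c₂
  have hg : ∀ n : ℕ, 2 * γ₁ ^ 2 / (n : ℝ) = (2 * γ₁) ^ 2 / 2 / n := fun n => by ring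
  have hg' : ∀ n : ℕ, 2 * γ₁ ^ 2 / (n : ℝ) = (-(2 * γ₁)) ^ 2 / 2 / n := fun n => by ring
  have h1 := tendsto_natCast_mul_norm_charFun_sub hmean hvar (2 * γ₁)
  have h2 := tendsto_natCast_mul_norm_charFun_sub hmean hvar (-(2 * γ₁))
  simp_rw [← hg] at h1
  simp_rw [← hg'] at h2
  have h3 := ((tendsto_inv_atTop_nhds_zero_nat (𝕜 := ℝ)).const_mul (2 * γ₁ ^ 2)).const_mul 3
  have h4 := (((h1.add h2).add h3).mul_const K)
  have h5 := (tendsto_sum_layerWeight_pow hmean hvar γ₁ γ₂ β₁ β₂ c₁ c₂).sub_const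
    (Complex.exp (pathExponent γ₁ γ₂ β₁ β₂ c₁ + pathExponent γ₁ γ₂ β₁ β₂ c₂))
  rw [sub_self] at h5
  have h6 := h4.add h5.norm
  rw [mul_zero, mul_zero, add_zero, add_zero, zero_mul, norm_zero, add_zero] at h6
  refine ⟨_, h6, hK.mono fun n hn e => ?_⟩
  refine (norm_sub_le_norm_sub_add_norm_sub _ (((∑ b, layerWeight μ γ₁ γ₂ β₁ β₂ n c₁ c₂ b *
    (damping (Real.exp (-(2 * γ₁ ^ 2))) b : ℂ)) ^ (n - 2))) _).trans (add_le_add ?_ le_rfl)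
  -- The law need not be symmetric, so δ adds the errors at 2γ₁ and -2γ₁.
  refine (norm_bulkSum_sub_le μ γ₁ γ₂ β₁ β₂ e c₁ c₂
    (δ := ‖charFun μ (2 * γ₁ / Real.sqrt n) - Real.exp (-(2 * γ₁ ^ 2 / n))‖ +
      ‖charFun μ (-(2 * γ₁) / Real.sqrt n) - Real.exp (-(2 * γ₁ ^ 2 / n))‖)
    (le_add_of_nonneg_right (norm_nonneg _)) (le_add_of_nonneg_left (norm_nonneg _))).trans ?_
  rw [mul_add, div_eq_mul_inv (2 * γ₁ ^ 2)]
  exact mul_le_mul_of_nonneg_left hn (by positivity)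

variable (γ₁ γ₂ β₁ β₂ : ℝ)

theorem integrable_path_term (hμ : Integrable (fun x : ℝ => x) μ) {n : ℕ} (e : Pairs n)
    (q : Fin n → SpinPath) (w : ℂ) :
    Integrable (fun J : Pairs n → ℝ => w * (J e * Complex.exp (Complex.I * (∑ e' : Pairs n,
      J e' * (phase γ₁ γ₂ (q e'.1.1) (q e'.1.2) / Real.sqrt n) : ℝ)))) (couplingLaw μ n) := by
  refine Integrable.const_mul ?_ w
  rw [couplingLaw]
  exact integrable_mul_exp_sum hμ
    (fun e' : Pairs n => phase γ₁ γ₂ (q e'.1.1) (q e'.1.2) / Real.sqrt n) e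

theorem integrable_energyDensity (hμ : Integrable (fun x : ℝ => x) μ) (n : ℕ) :
    Integrable (fun J : Pairs n → ℝ => energyDensity J 2 ![γ₁, γ₂] ![β₁, β₂])
      (couplingLaw μ n) := by
  simp_rw [energyDensity_two_eq]
  exact (integrable_finsetSum _ fun e _ => integrable_finsetSum _ fun q _ =>
    integrable_path_term γ₁ γ₂ hμ e q _).const_mul _

theorem integral_energyDensity (hμ : Integrable (fun x : ℝ => x) μ) (n : ℕ) :
    ∫ J : Pairs n → ℝ, energyDensity J 2 ![γ₁, γ₂] ![β₁, β₂] ∂(couplingLaw μ n) =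
      (1 / (n : ℂ)) * (1 / Real.sqrt n : ℝ) * ∑ e : Pairs n, ∑ c₁, ∑ c₂,
        coreWeight β₁ β₂ c₁ * coreWeight β₁ β₂ c₂ *
        charMoment μ (phase γ₁ γ₂ c₁ c₂ / Real.sqrt n) * bulkSum μ γ₁ γ₂ β₁ β₂ e c₁ c₂ := by
  simp_rw [energyDensity_two_eq]
  rw [integral_const_mul, integral_finsetSum _ fun e _ => integrable_finsetSum _ fun q _ =>
    integrable_path_term γ₁ γ₂ hμ e q _]
  congr 1
  refine Finset.sum_congr rfl fun e _ => ?_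
  rw [integral_finsetSum _ fun q _ => integrable_path_term γ₁ γ₂ hμ e q _,
    ← sum_path_eq_sum_core]
  refine Finset.sum_congr rfl fun q _ => ?_
  rw [integral_const_mul, couplingLaw, integral_mul_exp_sum μ
    (fun e' : Pairs n => phase γ₁ γ₂ (q e'.1.1) (q e'.1.2) / Real.sqrt n) e]

/-- Averages over pairs of a uniformly convergent family. -/
theorem tendsto_sum_pairs_div {x : ∀ n : ℕ, Pairs n → ℂ} {l : ℂ} {η : ℕ → ℝ}
    (hη : Tendsto η atTop (𝓝 0)) (hx : ∀ᶠ n in atTop, ∀ e, ‖x n e - l‖ ≤ η n) :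
    Tendsto (fun n : ℕ => (∑ e, x n e) / (n : ℂ) ^ 2) atTop (𝓝 (l / 2)) := by
  have h1 := tendsto_card_pairs_div.mul_const l
  have h2 : Tendsto (fun n : ℕ => (∑ e, (x n e - l)) / (n : ℂ) ^ 2) atTop (𝓝 0) := by
    refine squeeze_zero_norm' ?_ hη
    filter_upwards [hx, eventually_gt_atTop 1] with n hn hn1
    have hn0 : (0 : ℝ) < (n : ℝ) ^ 2 := by positivity
    have hc : (Fintype.card (Pairs n) : ℝ) ≤ (n : ℝ) ^ 2 := by
      have := two_mul_card_pairs n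
      exact_mod_cast (by omega : Fintype.card (Pairs n) ≤ n ^ 2)
    -- Nonnegativity of the bound needs at least one pair, hence n ≥ 2.
    have hη0 : 0 ≤ η n := (norm_nonneg _).trans (hn ⟨(⟨0, by omega⟩, ⟨1, hn1⟩), by simp [Fin.lt_def]⟩)
    rw [norm_div, norm_pow, RCLike.norm_natCast, div_le_iff₀ hn0]
    refine (norm_sum_le _ _).trans ((Finset.sum_le_card_nsmul _ _ _ fun e _ => hn e).trans ?_)
    rw [nsmul_eq_mul, Finset.card_univ, mul_comm]
    exact mul_le_mul_of_nonneg_left hc hη0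
  have h3 := h2.add h1
  rw [zero_add, one_div_mul_eq_div] at h3
  refine h3.congr fun n => ?_
  rw [Finset.sum_sub_distrib, Finset.sum_const, Finset.card_univ, nsmul_eq_mul]
  ring

theorem tendsto_integral_energyDensity (hL2 : MemLp (fun x : ℝ => x) 2 μ)
    (hmean : ∫ x, x ∂μ = 0) (hvar : ∫ x, x ^ 2 ∂μ = 1) :
    Tendsto (fun n : ℕ => ∫ J, energyDensity J 2 ![γ₁, γ₂] ![β₁, β₂] ∂(couplingLaw μ n)) atTop
      (𝓝 (((γ₁ * Gamma1 γ₁ γ₂ β₁ β₂ + γ₂ * Gamma2 γ₁ γ₂ β₁ β₂) *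
        Real.exp (-2 * (γ₁ ^ 2 + γ₂ ^ 2)) : ℝ) : ℂ)) := by
  have hμ : Integrable (fun x : ℝ => x) μ := hL2.integrable (by norm_num)
  rw [← sum_limitWeight_phase]
  have hterm : ∀ c₁ c₂ : SpinPath, Tendsto (fun n : ℕ => coreWeight β₁ β₂ c₁ * coreWeight β₁ β₂ c₂ *
      ((Real.sqrt n : ℂ) * charMoment μ (phase γ₁ γ₂ c₁ c₂ / Real.sqrt n)) *
        ((∑ e : Pairs n, bulkSum μ γ₁ γ₂ β₁ β₂ e c₁ c₂) / (n : ℂ) ^ 2)) atTop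
      (𝓝 (limitWeight γ₁ γ₂ β₁ β₂ c₁ * limitWeight γ₁ γ₂ β₁ β₂ c₂ *
        (Complex.I * phase γ₁ γ₂ c₁ c₂) / 2)) := by
    intro c₁ c₂
    obtain ⟨η, hη, hb⟩ := exists_norm_bulkSum_sub_le hmean hvar γ₁ γ₂ β₁ β₂ c₁ c₂
    have h := ((tendsto_sqrt_mul_charMoment hL2 hmean hvar (phase γ₁ γ₂ c₁ c₂)).const_mul
      (coreWeight β₁ β₂ c₁ * coreWeight β₁ β₂ c₂)).mul (tendsto_sum_pairs_div hη hb)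
    refine h.trans (le_of_eq ?_)
    congr 1
    rw [limitWeight, limitWeight, Complex.exp_add]
    ring
  have hcomm : ∀ {n : ℕ} (F : Pairs n → SpinPath → SpinPath → ℂ),
      ∑ e, ∑ c₁, ∑ c₂, F e c₁ c₂ = ∑ c₁, ∑ c₂, ∑ e, F e c₁ c₂ := by
    intro n F
    rw [Finset.sum_comm]
    exact Finset.sum_congr rfl fun _ _ => Finset.sum_comm
  refine (tendsto_finsetSum _ fun c₁ _ => tendsto_finsetSum _ fun c₂ _ =>
    hterm c₁ c₂).congr' ?_
  filter_upwards [eventually_gt_atTop 0] with n hn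
  -- The prefactor is split into √n, which normalises `charMoment`, and 1/n², which averages over
  -- pairs.
  have hs : (1 / (n : ℂ)) * (1 / Real.sqrt n : ℝ) = (Real.sqrt n : ℂ) / (n : ℂ) ^ 2 := by
    have hn' : (0 : ℝ) < n := by exact_mod_cast hn
    have h1 : 1 / Real.sqrt n = Real.sqrt n / n := by
      rw [Real.sqrt_div_self']
    rw [h1]
    push_cast
    field_simp
  rw [integral_energyDensity γ₁ γ₂ β₁ β₂ hμ, hs, hcomm, Finset.mul_sum]
  refine Finset.sum_congr rfl fun c₁ _ => ?_
  rw [Finset.mul_sum]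
  refine Finset.sum_congr rfl fun c₂ _ => ?_
  rw [← Finset.mul_sum]
  ring

end

end SKQAOA

theorem mainTheorem4 (μ : MeasureTheory.Measure ℝ) [MeasureTheory.IsProbabilityMeasure μ]
    (hL2 : MeasureTheory.MemLp (fun x : ℝ => x) 2 μ)
    (hmean : ∫ x, x ∂μ = 0) (hvar : ∫ x, x ^ 2 ∂μ = 1)
    (γ₁ γ₂ β₁ β₂ : ℝ) :
    (∀ n : ℕ, MeasureTheory.Integrable
      (fun J : SKQAOA.Pairs n → ℝ => SKQAOA.energyDensity J 2 ![γ₁, γ₂] ![β₁, β₂])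
      (SKQAOA.couplingLaw μ n)) ∧
    Filter.Tendsto
      (fun n : ℕ => ∫ J, SKQAOA.energyDensity J 2 ![γ₁, γ₂] ![β₁, β₂] ∂(SKQAOA.couplingLaw μ n))
      Filter.atTop
      (nhds (((γ₁ * SKQAOA.Gamma1 γ₁ γ₂ β₁ β₂ + γ₂ * SKQAOA.Gamma2 γ₁ γ₂ β₁ β₂)
        * Real.exp (-2 * (γ₁ ^ 2 + γ₂ ^ 2)) : ℝ) : ℂ)) :=
  ⟨SKQAOA.integrable_energyDensity γ₁ γ₂ β₁ β₂ (hL2.integrable (by norm_num)),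
    SKQAOA.tendsto_integral_energyDensity γ₁ γ₂ β₁ β₂ hL2 hmean hvar⟩
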